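/- **Conventions.** Let $A$ be a (not necessarily unital) $C^*$-algebra. A pure state of $A$ is an extreme point of the set of states (positive linear functionals of norm one); $\pi_\omega$ is the GNS representation of a state $\omega$. Write $\omega\sim\varphi$ if $\pi_\omega$ and $\pi_\varphi$ are unitarily equivalent; $\omega,\varphi$ are disjoint if there is no non-zero bounded intertwining operator between $\pi_\omega$ and $\pi_\varphi$. $\mathcal U(A)$ is the unitary group of $A$ if $A$ is unital, and of $A+\mathbb C1$ otherwise, with the norm topology; $\mathrm{Ad}\,u(x)=uxu^*$. $\mathrm{AI}(A)$ is the set of asymptotically inner automorphisms: those automorphisms $\alpha$ in the closure of $\{\mathrm{Ad}\,u : u\in\mathcal U(A)\}$ for pointwise norm convergence for which there is a continuous path $(u_t)_{t\in[0,1)}$ in $\mathcal U(A)$ with $\alpha(x)=\lim_{t\to1}\mathrm{Ad}\,u_t(x)$ for all $x\in A$. **Property (S).** For every finite $\mathcal F\subset A$ and $\varepsilon>0$ there are a finite $\mathcal G\subset A$ and $\delta>0$ such that: whenever $B$ is a $C^*$-algebra containing $A$ as a $C^*$-subalgebra, $n$ is a natural number, and $\omega_1,\dots,\omega_n,\varphi_1,\dots,\varphi_n$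 are pure states of $B$ such that the $\omega_i$ are mutually disjoint, $\omega_i\sim\varphi_i$ for all $i$, and $|\omega_i(x)-\varphi_i(x)|<\delta$ for all $x\in\mathcal G$ and all $i$, there is a continuous path $(u_t)_{t\in[0,1]}$ in $\mathcal U(B)$ with $u_0=1$, $\omega_i=\varphi_i\circ\mathrm{Ad}\,u_1$ for all $i$, and $\|\mathrm{Ad}\,u_t(x)-x\|<\varepsilon$ for all $x\in\mathcal F$, $t\in[0,1]$. **Theorem.** Let $A$ be a separable $C^*$-algebra with Property (S). 1. Let $(\omega_i)_{1\le i\le n}$ and $(\varphi_i)_{1\le i\le n}$ be finite sequences of pure states of $A$ such that the $\omega_i$ are mutually disjoint, the $\varphi_i$ are mutually disjoint, and $\ker\pi_{\omega_i}=\ker\pi_{\varphi_i}$ for all $i$. Then there is an $\alpha\in\mathrm{AI}(A)$ such that $\omega_i=\varphi_i\circ\alpha$ for all $i=1,\dots,n$. 2. In particular, if $(\omega_i)_{1\le i\le n+1}$ are pure states of $A$ that are mutually disjoint, except possibly for the pair $\omega_1,\omega_{n+1}$, and all the kernels $\ker\pi_{\omega_i}$ are equal, then there is an $\alpha\in\mathrm{AI}(A)$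 such that $\omega_i\circ\alpha=\omega_{i+1}$ for $i=1,\dots,n$. (With $\omega_{n+1}=\omega_1$: finitely many mutually disjoint pure states with a common kernel can be cyclically shifted.) -/

import Mathlib

open scoped ComplexOrder CStarAlgebra Topology

noncomputable section

namespace PureStateTransitivity

universe u

/-! ### Unitaries, inner automorphisms -/

section Automorphisms

variable (A : Type u) [NonUnitalCStarAlgebra A]

/-- The unitary group `U(A)`: the unitary group of `A` if `A` is unital, and that of `A + ℂ1`
otherwise. Both cases are realized inside the unitary group of `A⁺¹ = A ⊕ ℂ`, with its norm
topology. If `A` has a unit `e`, a unitary `v` of `A` is identified with `v + (1 - e)`; these are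
precisely the unitaries of `A⁺¹` whose scalar part is `1`. If `A` has no unit, then
`A + ℂ1 = A⁺¹` and there is no restriction. -/
def unitaryGroup : Subgroup (unitary A⁺¹) where
  carrier := {u | (∃ e : A, ∀ a : A, e * a = a ∧ a * e = a) → (u : A⁺¹).fst = 1}
  mul_mem' := by
    intro u v hu hv he
    simp [hu he, hv he]
  one_mem' := by
    intro _
    simp
  inv_mem' := by
    intro u hu he
    simp [← Unitary.star_eq_inv, hu he]

variable {A}

theorem inr_snd_conj (u : unitary A⁺¹) (x : A) :
    (((u : A⁺¹) * (x : A⁺¹) * star (u : A⁺¹)).snd : A⁺¹) =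
      (u : A⁺¹) * (x : A⁺¹) * star (u : A⁺¹) := by
  ext <;> simp

/-- The automorphism `Ad u : x ↦ u x u*` of `A`, for a unitary `u` of `A⁺¹`
(note that `A` is an ideal of `A⁺¹`). -/
def Ad (u : unitary A⁺¹) : A ≃⋆ₐ[ℂ] A where
  toFun x := ((u : A⁺¹) * (x : A⁺¹) * star (u : A⁺¹)).snd
  invFun x := (((star u : unitary A⁺¹) : A⁺¹) * (x : A⁺¹) *
    star ((star u : unitary A⁺¹) : A⁺¹)).snd
  left_inv x := by
    apply Unitization.inr_injective (R := ℂ)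
    rw [inr_snd_conj, inr_snd_conj]
    simp only [Unitary.coe_star, star_star, mul_assoc, Unitary.coe_star_mul_self, mul_one]
    simp only [← mul_assoc, Unitary.coe_star_mul_self, one_mul]
  right_inv x := by
    apply Unitization.inr_injective (R := ℂ)
    rw [inr_snd_conj, inr_snd_conj]
    have h : (u : A⁺¹) * star (u : A⁺¹) = 1 := Unitary.mul_star_self_of_mem u.2
    simp only [Unitary.coe_star, star_star, mul_assoc, h, mul_one]
    rw [← mul_assoc, h, one_mul]
  map_mul' x y := by
    apply Unitization.inr_injective (R := ℂ)
    rw [Unitization.inr_mul, Unitization.inr_mul, inr_snd_conj, inr_snd_conj]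
    have h := inr_snd_conj u (x * y)
    rw [Unitization.inr_mul] at h
    rw [h]
    simp only [mul_assoc]
    rw [← mul_assoc (star (u : A⁺¹)) (u : A⁺¹), Unitary.coe_star_mul_self, one_mul]
  map_add' x y := by simp [mul_add, add_mul]
  map_star' x := by
    apply Unitization.inr_injective (R := ℂ)
    rw [inr_snd_conj, Unitization.inr_star, Unitization.inr_star, inr_snd_conj]
    simp [mul_assoc]
  map_smul' c x := by simp

theorem inr_Ad (u : unitary A⁺¹) (x : A) :
    ((Ad u x : A) : A⁺¹) = (u : A⁺¹) * (x : A⁺¹) * star (u : A⁺¹) :=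
  inr_snd_conj u x

/-- `α ∈ Ap(A)`: the automorphism `α` is approximately inner, that is, it lies in the closure of
`Inn(A) = {Ad u | u ∈ U(A)}` for the topology of strong (i.e. pointwise norm) convergence. -/
def IsApproximatelyInner (α : A ≃⋆ₐ[ℂ] A) : Prop :=
  (α : A → A) ∈ closure {f : A → A | ∃ u ∈ unitaryGroup A, f = Ad u}

/-- `α ∈ AI(A)`: the approximately inner automorphism `α` is asymptotically inner, that is, there is
a continuous path `(u t)`, `t ∈ [0,1)`, in `U(A)` with `α = lim_{t → 1} Ad (u t)` strongly. -/
def IsAsymptoticallyInner (α : A ≃⋆ₐ[ℂ] A) : Prop :=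
  IsApproximatelyInner α ∧
    ∃ u : ℝ → unitaryGroup A, ContinuousOn u (Set.Ico 0 1) ∧
      ∀ x : A, Filter.Tendsto (fun t => Ad (u t : unitary A⁺¹) x) (𝓝[<] 1) (𝓝 (α x))

end Automorphisms

/-! ### Representations on Hilbert spaces -/

section Representations

variable {A : Type u} [NonUnitalCStarAlgebra A]
  {H K : Type*} [NormedAddCommGroup H] [InnerProductSpace ℂ H] [CompleteSpace H]
  [NormedAddCommGroup K] [InnerProductSpace ℂ K] [CompleteSpace K]

/-- Unitary equivalence of representations. -/
def RepEquivalent (π : A →⋆ₙₐ[ℂ] (H →L[ℂ] H)) (ρ : A →⋆ₙₐ[ℂ] (K →L[ℂ] K)) : Prop :=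
  ∃ U : H ≃ₗᵢ[ℂ] K, ∀ (a : A) (ξ : H), U (π a ξ) = ρ a (U ξ)

/-- Disjointness of representations: there is no non-zero bounded intertwining operator. -/
def RepDisjoint (π : A →⋆ₙₐ[ℂ] (H →L[ℂ] H)) (ρ : A →⋆ₙₐ[ℂ] (K →L[ℂ] K)) : Prop :=
  ∀ T : H →L[ℂ] K, (∀ (a : A) (ξ : H), T (π a ξ) = ρ a (T ξ)) → T = 0

end Representations

/-! ### Pure states and their GNS representations -/

section States

variable {A : Type u} [NonUnitalCStarAlgebra A] [PartialOrder A] [StarOrderedRing A]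

variable (A) in
/-- The state space `S(A)`: the positive linear functionals of norm one. -/
def stateSpace : Set (A →L[ℂ] ℂ) :=
  {f | (∀ a : A, 0 ≤ a → 0 ≤ f a) ∧ ‖f‖ = 1}

/-- A positive linear functional (which is automatically bounded) as an element of the dual. -/
def toDual (f : A →ₚ[ℂ] ℂ) : A →L[ℂ] ℂ :=
  ⟨f.toLinearMap, map_continuous f⟩

/-- A pure state is an extreme point of the state space. -/
def IsPureState (f : A →ₚ[ℂ] ℂ) : Prop :=
  toDual f ∈ (stateSpace A).extremePoints ℝ

/-- `f ∼ g`: the GNS representations of `f` and `g` are (unitarily) equivalent. -/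
def StateEquivalent (f g : A →ₚ[ℂ] ℂ) : Prop :=
  RepEquivalent f.gnsNonUnitalStarAlgHom g.gnsNonUnitalStarAlgHom

/-- `f` and `g` are disjoint: their GNS representations are disjoint. -/
def StateDisjoint (f g : A →ₚ[ℂ] ℂ) : Prop :=
  RepDisjoint f.gnsNonUnitalStarAlgHom g.gnsNonUnitalStarAlgHom

/-- The kernel of the GNS representation of `f`. -/
def gnsKer (f : A →ₚ[ℂ] ℂ) : Set A :=
  {a | f.gnsNonUnitalStarAlgHom a = 0}

end States

/-! ### The property -/

/-- For any finite `F ⊆ A` and `ε > 0` there are a finite `G ⊆ A` and `δ > 0` such that, for every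
C⋆-algebra `B` containing `A` as a C⋆-subalgebra (through an injective ⋆-homomorphism `ι`), every
`n`, and all pure states `ω i`, `φ i` (`i < n`) of `B` such that the `ω i` are mutually disjoint,
`ω i ∼ φ i`, and `|ω i (x) - φ i (x)| < δ` for `x ∈ G`, there is a continuous path `(u t)`,
`t ∈ [0,1]`, in `U(B)` with `u 0 = 1`, `ω i = φ i ∘ Ad (u 1)` for all `i`, and
`‖Ad (u t) (x) - x‖ < ε` for all `x ∈ F` and all `t`. -/
def StrongTransitivityProperty (A : Type u) [NonUnitalCStarAlgebra A] : Prop :=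
  ∀ (F : Finset A) (ε : ℝ), 0 < ε → ∃ (G : Finset A) (δ : ℝ), 0 < δ ∧
    ∀ (B : Type u) [NonUnitalCStarAlgebra B] [PartialOrder B] [StarOrderedRing B]
      (ι : A →⋆ₙₐ[ℂ] B), Function.Injective ι →
    ∀ (n : ℕ) (ω φ : Fin n → (B →ₚ[ℂ] ℂ)),
      (∀ i, IsPureState (ω i)) → (∀ i, IsPureState (φ i)) →
      (∀ i j, i ≠ j → StateDisjoint (ω i) (ω j)) →
      (∀ i, StateEquivalent (ω i) (φ i)) →
      (∀ i, ∀ x ∈ G, ‖ω i (ι x) - φ i (ι x)‖ < δ) →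
      ∃ u : C(unitInterval, unitaryGroup B),
        u 0 = 1 ∧
        (∀ i, ∀ b : B, ω i b = φ i (Ad (u 1 : unitary B⁺¹) b)) ∧
        ∀ x ∈ F, ∀ t, ‖Ad (u t : unitary B⁺¹) (ι x) - ι x‖ < ε

end PureStateTransitivity

end

/-!
Write `φ` and `ω` for the two given tuples of pure states. The automorphism is found by an
intertwining argument. Unitaries `C m` are constructed so that the tuples `φ ∘ Ad (C (2 k))` and
`ω ∘ Ad (C (2 k + 1))` get closer and closer on larger and larger finite sets, and so that
`C (m + 2) = C m * u m 1` for a path `u m` starting at `1` which almost commutes with the first `m`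
terms `x j` of a dense sequence and with `Ad (C m)⁻¹ (x j)`. Then `Ad (C (2 k))` and
`Ad (C (2 k + 1))` converge pointwise to automorphisms `α` and `β`, along the continuous paths
obtained by multiplying up the `u m` (`exists_path_tendsto_automorphism`), and `φ ∘ α = ω ∘ β`. So
`α ∘ β⁻¹` is the required asymptotically inner automorphism. The two tuples are corrected in turns
because the data with which `u m` has to commute involve `C m`: the tuples have to be close on the
finite set which property (S) attaches to these data, and this is arranged by the correction of the
other tuple, which leaves `C m` alone (`exists_intertwining_sequence`).

One correction (`exists_controlled_path`) replaces the pure states of one tuple by vector states in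
the same GNS representations that are very close to the other tuple, and property (S) supplies the
path of unitaries. This rests on two facts.

* Vector states of the GNS representation of a pure state `f` are pure and equivalent to `f`. This
  is irreducibility, in the form that positive operators in the commutant are scalars
  (`IsPureState.eq_smul_one_of_commute`).
* If `π_f` and `π_g` have the same kernel and `g` is pure, then `g` is a weak-* limit of vector
  states of `f` (`IsPureState.exists_vectorFunctional_near`): the Hahn-Banach theorem places `g` in
  the closed convex hull of the vector functionals, and Milman's theorem then places it in their
  closure, as `g` is extreme among the positive functionals of norm at most one.

The construction starts from a unitary which moves `ω` close to `φ`. Here property (S) also replaces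
Kadison's transitivity theorem: two unit vectors are joined by a path, and close vector states
on that path are conjugate (`exists_unitary_vectorFunctional`).
-/

noncomputable section

namespace PureStateTransitivity

open Filter PositiveLinearMap

universe u

/-! ### Positive functionals and their GNS representations -/

theorem rep_inner_left {A : Type*} [NonUnitalCStarAlgebra A] {H : Type*}
    [NormedAddCommGroup H] [InnerProductSpace ℂ H] [CompleteSpace H] (π : A →⋆ₙₐ[ℂ] (H →L[ℂ] H))
    (a : A) (x y : H) :
    inner ℂ (π a x) y = inner ℂ x (π (star a) y) := by
  rw [map_star, ContinuousLinearMap.star_eq_adjoint, ContinuousLinearMap.adjoint_inner_right]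

theorem adjoint_intertwines {A : Type*} [NonUnitalCStarAlgebra A] {H K : Type*}
    [NormedAddCommGroup H] [InnerProductSpace ℂ H] [CompleteSpace H]
    [NormedAddCommGroup K] [InnerProductSpace ℂ K] [CompleteSpace K]
    (π : A →⋆ₙₐ[ℂ] (H →L[ℂ] H)) (ρ : A →⋆ₙₐ[ℂ] (K →L[ℂ] K)) (R : H →L[ℂ] K)
    (hR : ∀ a x, R (π a x) = ρ a (R x)) (a : A) (y : K) :
    R.adjoint (ρ a y) = π a (R.adjoint y) := by
  refine ext_inner_left ℂ fun x => ?_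
  rw [ContinuousLinearMap.adjoint_inner_right, ← star_star a, ← rep_inner_left, ← hR,
    ← rep_inner_left, ContinuousLinearMap.adjoint_inner_right]

section GNS

variable {A : Type u} [NonUnitalCStarAlgebra A] [PartialOrder A] [StarOrderedRing A]

@[simp] theorem toDual_apply (f : A →ₚ[ℂ] ℂ) (a : A) : toDual f a = f a := rfl

/-- The class of `a` in the GNS space of `f`. -/
def gnsVec (f : A →ₚ[ℂ] ℂ) : A →ₗ[ℂ] f.GNS :=
  (UniformSpace.Completion.toComplL (𝕜 := ℂ) (E := f.PreGNS)).toLinearMap ∘ₗ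
    f.toPreGNS.toLinearMap

theorem gnsVec_apply (f : A →ₚ[ℂ] ℂ) (a : A) :
    gnsVec f a = ((f.toPreGNS a : f.PreGNS) : f.GNS) := rfl

theorem denseRange_gnsVec (f : A →ₚ[ℂ] ℂ) : DenseRange (gnsVec f) :=
  UniformSpace.Completion.denseRange_coe.comp f.toPreGNS.surjective.denseRange
    (UniformSpace.Completion.continuous_coe _)

theorem gns_gnsVec (f : A →ₚ[ℂ] ℂ) (a b : A) :
    f.gnsNonUnitalStarAlgHom a (gnsVec f b) = gnsVec f (a * b) := by
  simp [gnsVec_apply]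

theorem inner_gnsVec (f : A →ₚ[ℂ] ℂ) (a b : A) :
    inner ℂ (gnsVec f a) (gnsVec f b) = f (star a * b) := by
  rw [gnsVec_apply, gnsVec_apply, UniformSpace.Completion.inner_coe, preGNS_inner_def]
  rfl

theorem norm_gnsVec_sq (f : A →ₚ[ℂ] ℂ) (a : A) :
    ‖gnsVec f a‖ ^ 2 = (f (star a * a)).re := by
  rw [← inner_gnsVec, inner_self_eq_norm_sq_to_K]
  norm_cast

theorem gns_norm_le (f : A →ₚ[ℂ] ℂ) (a : A) : ‖f.gnsNonUnitalStarAlgHom a‖ ≤ ‖a‖ :=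
  NonUnitalStarAlgHom.norm_apply_le _ a

theorem tendsto_approximateUnit_mul (a : A) :
    Tendsto (fun e : A => e * a) (CStarAlgebra.approximateUnit A) (𝓝 a) :=
  (CStarAlgebra.increasingApproximateUnit (A := A)).tendsto_mul_right a

theorem approximateUnit_neBot : (CStarAlgebra.approximateUnit A).NeBot :=
  (CStarAlgebra.increasingApproximateUnit (A := A)).toIsApproximateUnit.neBot

theorem re_apply_star_mul_self_le (f : A →ₚ[ℂ] ℂ) {a : A} (ha : ‖a‖ ≤ 1) :
    (f (star a * a)).re ≤ ‖toDual f‖ := by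
  calc (f (star a * a)).re ≤ ‖toDual f (star a * a)‖ := Complex.re_le_norm _
    _ ≤ ‖toDual f‖ * ‖star a * a‖ := (toDual f).le_opNorm _
    _ ≤ ‖toDual f‖ * 1 := by
        rw [CStarRing.norm_star_mul_self]
        gcongr
        nlinarith [norm_nonneg a]
    _ = _ := mul_one _

theorem norm_gnsVec_sq_le (f : A →ₚ[ℂ] ℂ) {a : A} (ha : ‖a‖ ≤ 1) :
    ‖gnsVec f a‖ ^ 2 ≤ ‖toDual f‖ := by
  rw [norm_gnsVec_sq]
  exact re_apply_star_mul_self_le f ha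

/-- The norm of a positive functional is its limit along the squares of an approximate unit. In
particular the norm is additive on positive functionals. -/
theorem tendsto_norm_toDual (f : A →ₚ[ℂ] ℂ) :
    Tendsto (fun e : A => (f (star e * e)).re) (CStarAlgebra.approximateUnit A)
      (𝓝 ‖toDual f‖) := by
  have hun := CStarAlgebra.increasingApproximateUnit (A := A)
  have hle : ∀ᶠ e in CStarAlgebra.approximateUnit A, (f (star e * e)).re ≤ ‖toDual f‖ :=
    hun.eventually_norm.mono fun e he => re_apply_star_mul_self_le f he
  rw [tendsto_order]
  refine ⟨fun c hc => ?_, fun c hc => hle.mono fun e he => he.trans_lt hc⟩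
  rcases lt_or_ge c 0 with hc0 | hc0
  · exact Eventually.of_forall fun e => hc0.trans_le (by rw [← norm_gnsVec_sq]; positivity)
  have hN : 0 < ‖toDual f‖ := hc0.trans_lt hc
  -- By Cauchy-Schwarz `|f (e a)|² ≤ f (e* e) ‖f‖`, and `f (e a) → f a` with `|f a|` close to `‖f‖`.
  obtain ⟨a, ha1, ha⟩ : ∃ a : A, ‖a‖ < 1 ∧ √(c * ‖toDual f‖) < ‖toDual f a‖ := by
    refine (toDual f).exists_lt_apply_of_lt_opNorm ?_
    rw [Real.sqrt_lt' hN]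
    nlinarith
  have hlim : Tendsto (fun e : A => ‖toDual f (e * a)‖) (CStarAlgebra.approximateUnit A)
      (𝓝 ‖toDual f a‖) :=
    (((toDual f).continuous.tendsto a).comp (tendsto_approximateUnit_mul a)).norm
  filter_upwards [hlim.eventually_const_lt ha, hun.eventually_star_eq] with e he hes
  have h1 : ‖toDual f (e * a)‖ ≤ ‖gnsVec f e‖ * ‖gnsVec f a‖ := by
    have := norm_inner_le_norm (𝕜 := ℂ) (gnsVec f e) (gnsVec f a)
    rwa [inner_gnsVec, hes] at this
  have h2 := norm_gnsVec_sq_le f ha1.le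
  rw [← norm_gnsVec_sq]
  rw [Real.sqrt_lt' (by linarith [Real.sqrt_nonneg (c * ‖toDual f‖)])] at he
  have h3 : ‖toDual f (e * a)‖ ^ 2 ≤ ‖gnsVec f e‖ ^ 2 * ‖toDual f‖ := by
    calc _ ≤ (‖gnsVec f e‖ * ‖gnsVec f a‖) ^ 2 := by gcongr
      _ = ‖gnsVec f e‖ ^ 2 * ‖gnsVec f a‖ ^ 2 := mul_pow _ _ _
      _ ≤ _ := by gcongr
  exact lt_of_mul_lt_mul_right (he.trans_le h3) hN.le

/-- The GNS representation is non-degenerate. -/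
theorem tendsto_gns_approximateUnit (f : A →ₚ[ℂ] ℂ) (ξ : f.GNS) :
    Tendsto (fun e : A => f.gnsNonUnitalStarAlgHom e ξ) (CStarAlgebra.approximateUnit A)
      (𝓝 ξ) := by
  have hun := CStarAlgebra.increasingApproximateUnit (A := A)
  rw [Metric.tendsto_nhds]
  intro ε hε
  obtain ⟨_, ⟨b, rfl⟩, hb⟩ :=
    Metric.mem_closure_iff.1 (denseRange_gnsVec f ξ) (ε / 3) (by positivity)
  have hcont : Continuous (gnsVec f) := by
    refine AddMonoidHomClass.continuous_of_bound (gnsVec f) (√‖toDual f‖) fun a => ?_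
    rw [← sq_le_sq₀ (by positivity) (by positivity), norm_gnsVec_sq, mul_pow,
      Real.sq_sqrt (norm_nonneg _)]
    calc (f (star a * a)).re ≤ ‖toDual f (star a * a)‖ := Complex.re_le_norm _
      _ ≤ ‖toDual f‖ * ‖star a * a‖ := (toDual f).le_opNorm _
      _ = _ := by rw [CStarRing.norm_star_mul_self, sq]
  have hlim := Metric.tendsto_nhds.1 ((hcont.tendsto b).comp (tendsto_approximateUnit_mul b))
    (ε / 3) (by positivity)
  filter_upwards [hlim, hun.eventually_norm] with e he he1
  simp only [Function.comp_apply, ← gns_gnsVec] at he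
  have h1 : dist (f.gnsNonUnitalStarAlgHom e ξ) (f.gnsNonUnitalStarAlgHom e (gnsVec f b))
      ≤ dist ξ (gnsVec f b) := by
    rw [dist_eq_norm, dist_eq_norm, ← map_sub]
    refine (ContinuousLinearMap.le_of_opNorm_le _ ((gns_norm_le f e).trans he1) _).trans ?_
    rw [one_mul]
  have := dist_triangle4 (f.gnsNonUnitalStarAlgHom e ξ) (f.gnsNonUnitalStarAlgHom e (gnsVec f b))
    (gnsVec f b) ξ
  rw [dist_comm (gnsVec f b) ξ] at this
  linarith

/-- The cyclic vector of the GNS representation. It is obtained from the Riesz representation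
theorem, since `A` need not have a unit. -/
theorem exists_cyclic_vector (f : A →ₚ[ℂ] ℂ) :
    ∃ Ω : f.GNS, (∀ a, f.gnsNonUnitalStarAlgHom a Ω = gnsVec f a) ∧
      ∀ a, inner ℂ Ω (gnsVec f a) = f a := by
  have hbound : ∀ a, ‖(f.toLinearMap : A →ₗ[ℂ] ℂ) a‖ ≤ √‖toDual f‖ * ‖gnsVec f a‖ := by
    intro a
    have := approximateUnit_neBot (A := A)
    have hun := CStarAlgebra.increasingApproximateUnit (A := A)
    have hlim : Tendsto (fun e : A => ‖toDual f (e * a)‖) (CStarAlgebra.approximateUnit A)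
        (𝓝 ‖toDual f a‖) :=
      (((toDual f).continuous.tendsto a).comp (tendsto_approximateUnit_mul a)).norm
    refine le_of_tendsto hlim ?_
    filter_upwards [hun.eventually_star_eq, hun.eventually_norm] with e hes he1
    have h1 := norm_inner_le_norm (𝕜 := ℂ) (gnsVec f e) (gnsVec f a)
    rw [inner_gnsVec, hes] at h1
    refine h1.trans ?_
    gcongr
    exact Real.le_sqrt_of_sq_le (norm_gnsVec_sq_le f he1)
  set ℓ : f.GNS →L[ℂ] ℂ := (f.toLinearMap : A →ₗ[ℂ] ℂ).extendOfNorm (gnsVec f)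
  have hℓ : ∀ a, ℓ (gnsVec f a) = f a :=
    LinearMap.extendOfNorm_eq (denseRange_gnsVec f) ⟨_, hbound⟩
  have hΩ : ∀ a, inner ℂ ((InnerProductSpace.toDual ℂ f.GNS).symm ℓ) (gnsVec f a) = f a := by
    intro a
    rw [InnerProductSpace.toDual_symm_apply, hℓ]
  refine ⟨(InnerProductSpace.toDual ℂ f.GNS).symm ℓ, fun a => ?_, hΩ⟩
  refine (denseRange_gnsVec f).eq_of_inner_left ℂ fun b => ?_
  rw [rep_inner_left, gns_gnsVec, hΩ, inner_gnsVec]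

/-- An `A`-linear map `j` from `A` to a representation space with `‖j a‖² ≤ g (a* a)` factors
through an intertwiner from the GNS representation of `g`. -/
theorem exists_intertwiner {H : Type*} [NormedAddCommGroup H] [InnerProductSpace ℂ H]
    [CompleteSpace H] (π : A →⋆ₙₐ[ℂ] (H →L[ℂ] H)) (g : A →ₚ[ℂ] ℂ) (j : A →ₗ[ℂ] H)
    (hj : ∀ a, ‖j a‖ ^ 2 ≤ (g (star a * a)).re) (hπ : ∀ a b, j (a * b) = π a (j b)) :
    ∃ R : g.GNS →L[ℂ] H, (∀ a, R (gnsVec g a) = j a) ∧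
      ∀ a x, R (g.gnsNonUnitalStarAlgHom a x) = π a (R x) := by
  have hbound : ∀ a, ‖j a‖ ≤ 1 * ‖gnsVec g a‖ := by
    intro a
    rw [one_mul, ← sq_le_sq₀ (by positivity) (by positivity), norm_gnsVec_sq]
    exact hj a
  have hR : ∀ a, j.extendOfNorm (gnsVec g) (gnsVec g a) = j a :=
    LinearMap.extendOfNorm_eq (denseRange_gnsVec g) ⟨_, hbound⟩
  refine ⟨j.extendOfNorm (gnsVec g), hR, fun a x => ?_⟩
  refine congr_fun ((denseRange_gnsVec g).equalizer
    (g := fun x => j.extendOfNorm (gnsVec g) (g.gnsNonUnitalStarAlgHom a x))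
    (h := fun x => π a (j.extendOfNorm (gnsVec g) x)) (by fun_prop) (by fun_prop)
    (funext fun b => ?_)) x
  simp only [Function.comp_apply]
  rw [gns_gnsVec, hR, hR, hπ]

end GNS

/-! ### Pure states, irreducibility and vector states -/

theorem zero_le_inner_self {H : Type*} [NormedAddCommGroup H] [InnerProductSpace ℂ H] (x : H) :
    0 ≤ inner ℂ x x := by
  rw [inner_self_eq_norm_sq_to_K, ← RCLike.ofReal_pow]
  exact RCLike.ofReal_nonneg.2 (sq_nonneg _)

section Pure

variable {A : Type u} [NonUnitalCStarAlgebra A] [PartialOrder A] [StarOrderedRing A]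

/-- A linear functional which is positive on the elements `a* a`, as a positive functional. -/
def positiveOfStarMulSelf (f : A →ₗ[ℂ] ℂ) (hf : ∀ a, 0 ≤ f (star a * a)) : A →ₚ[ℂ] ℂ :=
  .mk₀ f fun a ha => by
    obtain ⟨b, rfl⟩ := CStarAlgebra.nonneg_iff_eq_star_mul_self.1 ha
    exact hf b

/-- The vector functional `a ↦ ⟪ξ, π(a) ξ⟫` of the GNS representation `π` of `f`. -/
def vectorFunctional (f : A →ₚ[ℂ] ℂ) (ξ : f.GNS) : A →ₚ[ℂ] ℂ :=
  positiveOfStarMulSelf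
    { toFun := fun a => inner ℂ ξ (f.gnsNonUnitalStarAlgHom a ξ)
      map_add' := fun a b => by rw [map_add, _root_.add_apply, inner_add_right]
      map_smul' := fun c a => by
        rw [map_smul, smul_apply, inner_smul_right]; rfl } fun a => by
    simp only [LinearMap.coe_mk, AddHom.coe_mk, map_mul, mul_apply_eq_comp]
    rw [← rep_inner_left]
    exact zero_le_inner_self _

theorem vectorFunctional_apply (f : A →ₚ[ℂ] ℂ) (ξ : f.GNS) (a : A) :
    vectorFunctional f ξ a = inner ℂ ξ (f.gnsNonUnitalStarAlgHom a ξ) := rfl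

theorem vectorFunctional_star_mul (f : A →ₚ[ℂ] ℂ) (ξ : f.GNS) (a b : A) :
    vectorFunctional f ξ (star a * b) =
      inner ℂ (f.gnsNonUnitalStarAlgHom a ξ) (f.gnsNonUnitalStarAlgHom b ξ) := by
  rw [vectorFunctional_apply, map_mul, mul_apply_eq_comp, ← rep_inner_left]

theorem vectorFunctional_star_mul_self_re (f : A →ₚ[ℂ] ℂ) (ξ : f.GNS) (a : A) :
    (vectorFunctional f ξ (star a * a)).re = ‖f.gnsNonUnitalStarAlgHom a ξ‖ ^ 2 := by
  rw [vectorFunctional_star_mul, inner_self_eq_norm_sq_to_K]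
  norm_cast

theorem norm_vectorFunctional (f : A →ₚ[ℂ] ℂ) (ξ : f.GNS) :
    ‖toDual (vectorFunctional f ξ)‖ = ‖ξ‖ ^ 2 := by
  have := approximateUnit_neBot (A := A)
  refine tendsto_nhds_unique (tendsto_norm_toDual _) ?_
  simp only [vectorFunctional_star_mul_self_re]
  exact (tendsto_gns_approximateUnit f ξ).norm.pow 2

theorem norm_toDual_add_eq {f g h : A →ₚ[ℂ] ℂ} {c : ℝ} (hfg : ∀ a, g a + h a = c * f a) :
    ‖toDual g‖ + ‖toDual h‖ = c * ‖toDual f‖ := by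
  have := approximateUnit_neBot (A := A)
  refine tendsto_nhds_unique ((tendsto_norm_toDual g).add (tendsto_norm_toDual h)) ?_
  refine ((tendsto_norm_toDual f).const_mul c).congr fun e => ?_
  rw [← Complex.add_re, hfg, Complex.re_ofReal_mul]

/-- A positive functional dominated by a multiple of a pure state is a multiple of it. -/
theorem IsPureState.eq_mul_of_add_eq {f g h : A →ₚ[ℂ] ℂ} (hf : IsPureState f) {c : ℝ} (hc : 0 < c)
    (hfg : ∀ a, g a + h a = c * f a) : ∃ t : ℂ, ∀ a, g a = t * f a := by
  obtain ⟨hfs, hext⟩ := mem_extremePoints_iff_left.1 hf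
  have hnorm := norm_toDual_add_eq hfg
  rw [hfs.2, mul_one] at hnorm
  have hzero : ∀ k : A →ₚ[ℂ] ℂ, ‖toDual k‖ = 0 → ∀ a, k a = 0 := fun k hk a => by
    rw [← toDual_apply, norm_eq_zero.1 hk, _root_.zero_apply]
  rcases (norm_nonneg (toDual g)).eq_or_lt with hg | hg
  · exact ⟨0, fun a => by rw [hzero g hg.symm, zero_mul]⟩
  rcases (norm_nonneg (toDual h)).eq_or_lt with hh | hh
  · exact ⟨c, fun a => by rw [← hfg, hzero h hh.symm, add_zero]⟩
  have hstate : ∀ k : A →ₚ[ℂ] ℂ, 0 < ‖toDual k‖ → ‖toDual k‖⁻¹ • toDual k ∈ stateSpace A := by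
    refine fun k hk => ⟨fun a ha => ?_, ?_⟩
    · exact smul_nonneg (inv_nonneg.2 hk.le) (k.map_nonneg ha)
    · rw [norm_smul, norm_inv, norm_norm, inv_mul_cancel₀ hk.ne']
  have hseg := hext _ (hstate g hg) _ (hstate h hh)
    ⟨‖toDual g‖ / c, ‖toDual h‖ / c, by positivity, by positivity, by
      rw [← add_div, hnorm, div_self hc.ne'], by
      ext a
      have hcc : (c : ℂ) ≠ 0 := by exact_mod_cast hc.ne'
      have hgc : ((‖toDual g‖ : ℝ) : ℂ) ≠ 0 := by exact_mod_cast hg.ne'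
      have hhc : ((‖toDual h‖ : ℝ) : ℂ) ≠ 0 := by exact_mod_cast hh.ne'
      simp only [_root_.add_apply, smul_apply, toDual_apply,
        Complex.real_smul, Complex.ofReal_div, Complex.ofReal_inv]
      field_simp
      exact hfg a⟩
  refine ⟨‖toDual g‖, fun a => ?_⟩
  have hgc : ((‖toDual g‖ : ℝ) : ℂ) ≠ 0 := by exact_mod_cast hg.ne'
  rw [← toDual_apply f, ← hseg]
  simp only [smul_apply, toDual_apply, Complex.real_smul, Complex.ofReal_inv]
  field_simp

theorem isPureState_of_forall_add_eq {f : A →ₚ[ℂ] ℂ} (hnorm : ‖toDual f‖ = 1)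
    (hf : ∀ g h : A →ₚ[ℂ] ℂ, (∀ a, g a + h a = f a) → ∃ t : ℂ, ∀ a, g a = t * f a) :
    IsPureState f := by
  have := approximateUnit_neBot (A := A)
  refine mem_extremePoints_iff_left.2 ⟨⟨fun a ha => f.map_nonneg ha, hnorm⟩, ?_⟩
  rintro g ⟨hg, hg1⟩ h ⟨hh, -⟩ ⟨s, r, hs, hr, -, hsum⟩
  let g' : A →ₚ[ℂ] ℂ := .mk₀ (s • g).toLinearMap fun a ha => smul_nonneg hs.le (hg a ha)
  let h' : A →ₚ[ℂ] ℂ := .mk₀ (r • h).toLinearMap fun a ha => smul_nonneg hr.le (hh a ha)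
  have hg' : toDual g' = s • g := rfl
  obtain ⟨t, ht⟩ := hf g' h' fun a => by
    rw [← toDual_apply f, ← hsum]; rfl
  have hgf : toDual g' = t • toDual f := ContinuousLinearMap.ext ht
  have hns : ‖toDual g'‖ = s := by
    rw [hg', norm_smul, hg1, mul_one, Real.norm_of_nonneg hs.le]
  have hnt : ‖t‖ = s := by rw [← hns, hgf, norm_smul, hnorm, mul_one]
  -- `t` is the limit of `g' (e* e)` along an approximate unit, hence equal to `s`.
  have hre : t.re = s := by
    rw [← hns, ← mul_one t.re, ← hnorm]
    refine tendsto_nhds_unique ?_ (tendsto_norm_toDual g')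
    refine ((tendsto_norm_toDual f).const_mul t.re).congr fun e => ?_
    have : (f (star e * e)).im = 0 := by
      rw [← inner_gnsVec]; exact inner_self_im (𝕜 := ℂ) _
    rw [ht, Complex.mul_re, this, mul_zero, sub_zero]
  have hts : t = s := by
    have := Complex.re_eq_norm.1 (hre.trans hnt.symm)
    rw [Complex.eq_re_of_ofReal_le this, hre]
  ext a
  have := ht a
  rw [← toDual_apply g', hg', hts] at this
  exact mul_left_cancel₀ (Complex.ofReal_ne_zero.2 hs.ne') this

/-- The GNS representation of a pure state is irreducible: positive operators commuting with it are
scalars. -/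
theorem IsPureState.eq_smul_one_of_commute {f : A →ₚ[ℂ] ℂ} (hf : IsPureState f)
    (T : f.GNS →L[ℂ] f.GNS) (hT : ∀ x, 0 ≤ inner ℂ x (T x))
    (hcomm : ∀ a x, T (f.gnsNonUnitalStarAlgHom a x) = f.gnsNonUnitalStarAlgHom a (T x)) :
    ∃ t : ℂ, ∀ x, T x = t • x := by
  obtain ⟨Ω, hΩ, hΩ'⟩ := exists_cyclic_vector f
  have key : ∀ S : f.GNS →L[ℂ] f.GNS, (∀ x, 0 ≤ inner ℂ x (S x)) →
      (∀ a x, S (f.gnsNonUnitalStarAlgHom a x) = f.gnsNonUnitalStarAlgHom a (S x)) →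
      ∃ g : A →ₚ[ℂ] ℂ, ∀ a, g a = inner ℂ Ω (S (gnsVec f a)) := by
    intro S hS hSc
    refine ⟨positiveOfStarMulSelf ((innerSL ℂ Ω ∘L S).toLinearMap ∘ₗ gnsVec f) fun a => ?_,
      fun a => rfl⟩
    simp only [LinearMap.comp_apply, ContinuousLinearMap.coe_coe,
      ContinuousLinearMap.comp_apply, innerSL_apply_apply]
    rw [← gns_gnsVec, hSc, ← rep_inner_left, hΩ]
    exact hS _
  obtain ⟨g, hg⟩ := key T hT hcomm
  set c : ℝ := ‖T‖ + 1 with hc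
  obtain ⟨h, hh⟩ := key ((c : ℂ) • 1 - T) (fun x => by
      have h1 : (inner ℂ x (T x)).re ≤ c * ‖x‖ ^ 2 := by
        refine (Complex.re_le_norm _).trans ((norm_inner_le_norm _ _).trans ?_)
        nlinarith [T.le_opNorm x, norm_nonneg x]
      have h2 : inner ℂ x (T x) = ((inner ℂ x (T x)).re : ℂ) :=
        Complex.eq_re_of_ofReal_le (r := 0) (by exact_mod_cast hT x)
      rw [sub_apply, inner_sub_right, smul_apply,
        one_apply_eq_self, inner_smul_right, inner_self_eq_norm_sq_to_K, h2,
        sub_nonneg]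
      have h3 := Complex.real_le_real.2 h1
      push_cast at h3
      exact h3) fun a x => by simp [hcomm]
  obtain ⟨t, ht⟩ := hf.eq_mul_of_add_eq (c := c) (g := g) (h := h) (by positivity) fun a => by
    have h1 : ((c : ℂ) • 1 - T) (gnsVec f a) = (c : ℂ) • gnsVec f a - T (gnsVec f a) := rfl
    rw [hg, hh, ← inner_add_right, h1, add_sub_cancel, inner_smul_right, hΩ']
  refine ⟨t, fun x => ?_⟩
  refine congr_fun ((denseRange_gnsVec f).equalizer (g := T) (h := fun x => t • x)
    T.continuous (continuous_const_smul t) (funext fun a => ?_)) x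
  refine (denseRange_gnsVec f).eq_of_inner_right ℂ fun b => ?_
  simp only [Function.comp_apply]
  rw [← hΩ b, rep_inner_left, rep_inner_left, map_smul, ← hcomm, gns_gnsVec, ← hg, ht,
    inner_smul_right, hΩ']

theorem exists_vectorFunctional_intertwiner (f : A →ₚ[ℂ] ℂ) (ξ : f.GNS) :
    ∃ W : (vectorFunctional f ξ).GNS →ₗᵢ[ℂ] f.GNS,
      (∀ a, W (gnsVec _ a) = f.gnsNonUnitalStarAlgHom a ξ) ∧
      ∀ a x, W ((vectorFunctional f ξ).gnsNonUnitalStarAlgHom a x) =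
        f.gnsNonUnitalStarAlgHom a (W x) := by
  obtain ⟨W, hW, hW'⟩ := exists_intertwiner f.gnsNonUnitalStarAlgHom (vectorFunctional f ξ)
    { toFun := fun a => f.gnsNonUnitalStarAlgHom a ξ
      map_add' := fun a b => by rw [map_add, _root_.add_apply]
      map_smul' := fun c a => by rw [map_smul, smul_apply]; rfl }
    (fun a => (vectorFunctional_star_mul_self_re f ξ a).ge)
    (fun a b => by simp)
  refine ⟨⟨W.toLinearMap, fun x => ?_⟩, hW, hW'⟩
  refine congr_fun ((denseRange_gnsVec _).equalizer (g := fun x => ‖W x‖) (h := fun x => ‖x‖)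
    (by fun_prop) (by fun_prop) (funext fun a => ?_)) x
  rw [Function.comp_apply, Function.comp_apply, hW, ← sq_eq_sq₀ (norm_nonneg _) (norm_nonneg _),
    norm_gnsVec_sq, vectorFunctional_star_mul_self_re]
  rfl

theorem apply_eq_mul_of_star_mul {f g : A →ₚ[ℂ] ℂ} {t : ℂ}
    (h : ∀ a b, f (star a * b) = t * g (star a * b)) (b : A) : f b = t * g b := by
  have := approximateUnit_neBot (A := A)
  have hun := CStarAlgebra.increasingApproximateUnit (A := A)
  have hlim := tendsto_approximateUnit_mul b
  refine tendsto_nhds_unique_of_eventuallyEq (((toDual f).continuous.tendsto b).comp hlim)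
    ((((toDual g).continuous.tendsto b).comp hlim).const_mul t) ?_
  filter_upwards [hun.eventually_star_eq] with e he
  have := h e b
  rwa [he] at this

theorem RepEquivalent.symm {A : Type*} [NonUnitalCStarAlgebra A] {H K : Type*}
    [NormedAddCommGroup H] [InnerProductSpace ℂ H] [CompleteSpace H]
    [NormedAddCommGroup K] [InnerProductSpace ℂ K] [CompleteSpace K]
    {π : A →⋆ₙₐ[ℂ] (H →L[ℂ] H)} {ρ : A →⋆ₙₐ[ℂ] (K →L[ℂ] K)} (h : RepEquivalent π ρ) :
    RepEquivalent ρ π := by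
  obtain ⟨U, hU⟩ := h
  refine ⟨U.symm, fun a ξ => ?_⟩
  apply U.injective
  rw [hU, U.apply_symm_apply, U.apply_symm_apply]

theorem RepEquivalent.trans {A : Type*} [NonUnitalCStarAlgebra A] {H K L : Type*}
    [NormedAddCommGroup H] [InnerProductSpace ℂ H] [CompleteSpace H]
    [NormedAddCommGroup K] [InnerProductSpace ℂ K] [CompleteSpace K]
    [NormedAddCommGroup L] [InnerProductSpace ℂ L] [CompleteSpace L]
    {π : A →⋆ₙₐ[ℂ] (H →L[ℂ] H)} {ρ : A →⋆ₙₐ[ℂ] (K →L[ℂ] K)} {σ : A →⋆ₙₐ[ℂ] (L →L[ℂ] L)}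
    (h : RepEquivalent π ρ) (h' : RepEquivalent ρ σ) : RepEquivalent π σ := by
  obtain ⟨U, hU⟩ := h
  obtain ⟨V, hV⟩ := h'
  exact ⟨U.trans V, fun a ξ => by simp [hU, hV]⟩

theorem StateEquivalent.symm {f g : A →ₚ[ℂ] ℂ} (h : StateEquivalent f g) : StateEquivalent g f :=
  RepEquivalent.symm h

theorem StateEquivalent.trans {f g h : A →ₚ[ℂ] ℂ} (hfg : StateEquivalent f g)
    (hgh : StateEquivalent g h) : StateEquivalent f h :=
  RepEquivalent.trans hfg hgh

theorem StateEquivalent.gnsKer_eq {f g : A →ₚ[ℂ] ℂ} (h : StateEquivalent f g) :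
    gnsKer f = gnsKer g := by
  have key : ∀ {f g : A →ₚ[ℂ] ℂ}, StateEquivalent f g → gnsKer f ⊆ gnsKer g := by
    rintro f g ⟨U, hU⟩ a (ha : f.gnsNonUnitalStarAlgHom a = 0)
    refine ContinuousLinearMap.ext fun x => ?_
    rw [← U.apply_symm_apply x, ← hU, ha, _root_.zero_apply, map_zero,
      _root_.zero_apply]
  exact (key h).antisymm (key h.symm)

theorem StateDisjoint.congr {f g f' g' : A →ₚ[ℂ] ℂ} (h : StateDisjoint f g)
    (hf : StateEquivalent f' f) (hg : StateEquivalent g' g) : StateDisjoint f' g' := by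
  obtain ⟨U, hU⟩ := hf.symm
  obtain ⟨V, hV⟩ := hg
  intro T hT
  have h0 := h (V.toContinuousLinearEquiv.toContinuousLinearMap ∘L T ∘L
    U.toContinuousLinearEquiv.toContinuousLinearMap) fun a ξ => by
      simp [hU, hT, hV]
  ext x
  have := DFunLike.congr_fun h0 (U.symm x)
  simpa using this

/-- Every nonzero vector of an irreducible representation is cyclic. -/
theorem IsPureState.vectorFunctional_equivalent {f : A →ₚ[ℂ] ℂ} (hf : IsPureState f) {ξ : f.GNS}
    (hξ : ‖ξ‖ = 1) : StateEquivalent (vectorFunctional f ξ) f := by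
  have := approximateUnit_neBot (A := A)
  obtain ⟨W, hW, hWi⟩ := exists_vectorFunctional_intertwiner f ξ
  set W' := W.toContinuousLinearMap with hW'
  have hWW : ∀ x, W'.adjoint (W' x) = x := fun x => by
    refine ext_inner_left ℂ fun y => ?_
    rw [ContinuousLinearMap.adjoint_inner_right]
    exact W.inner_map_map _ _
  have hadj := adjoint_intertwines _ _ W' hWi
  -- `W W*` is a positive operator in the commutant, hence a scalar, and it is the identity on the
  -- range of `W`.
  obtain ⟨t, ht⟩ := hf.eq_smul_one_of_commute (W' ∘L W'.adjoint) (fun x => by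
      rw [ContinuousLinearMap.comp_apply, ← ContinuousLinearMap.adjoint_inner_left]
      exact zero_le_inner_self _) fun a x => by
    simp only [ContinuousLinearMap.comp_apply]
    rw [hadj]
    exact hWi _ _
  obtain ⟨a, ha⟩ : ∃ a, f.gnsNonUnitalStarAlgHom a ξ ≠ 0 := by
    by_contra! h
    have h0 := tendsto_gns_approximateUnit f ξ
    simp only [h] at h0
    rw [← tendsto_nhds_unique tendsto_const_nhds h0, norm_zero] at hξ
    exact zero_ne_one hξ
  have ht1 : t = 1 := by
    have h1 := ht (W' (gnsVec _ a))
    rw [ContinuousLinearMap.comp_apply, hWW] at h1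
    have h2 : W' (gnsVec _ a) ≠ 0 := by
      rw [hW', LinearIsometry.coe_toContinuousLinearMap, hW]; exact ha
    exact smul_left_injective ℂ h2 (h1.symm.trans (one_smul ℂ _).symm)
  have hsurj : Function.Surjective W := fun x => ⟨W'.adjoint x, by
    have := ht x
    rwa [ht1, one_smul] at this⟩
  exact ⟨LinearIsometryEquiv.ofSurjective W hsurj, hWi⟩

theorem IsPureState.isPureState_vectorFunctional {f : A →ₚ[ℂ] ℂ} (hf : IsPureState f) {ξ : f.GNS}
    (hξ : ‖ξ‖ = 1) : IsPureState (vectorFunctional f ξ) := by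
  set φ := vectorFunctional f ξ with hφ
  obtain ⟨U, hU⟩ := hf.vectorFunctional_equivalent hξ
  refine isPureState_of_forall_add_eq (by rw [norm_vectorFunctional, hξ, one_pow]) ?_
  intro g h hgh
  -- `g ≤ φ` gives an intertwiner `S` from the GNS space of `φ` to that of `g`; then `S* S` is
  -- carried by the equivalence of `φ` and `f` to a positive operator in the commutant of `π_f`.
  obtain ⟨S, hS, hSi⟩ := exists_intertwiner g.gnsNonUnitalStarAlgHom φ (gnsVec g) (fun a => by
    rw [norm_gnsVec_sq, ← hgh, Complex.add_re, ← norm_gnsVec_sq h]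
    nlinarith [sq_nonneg ‖gnsVec h a‖]) fun a b => (gns_gnsVec g a b).symm
  have hadj := adjoint_intertwines _ _ S hSi
  have hUs : ∀ a x, U.symm (f.gnsNonUnitalStarAlgHom a x) =
      φ.gnsNonUnitalStarAlgHom a (U.symm x) := fun a x => by
    apply U.injective
    rw [hU, U.apply_symm_apply, U.apply_symm_apply]
  obtain ⟨t, ht⟩ := hf.eq_smul_one_of_commute
    (U.toContinuousLinearEquiv.toContinuousLinearMap ∘L S.adjoint ∘L S ∘L
      U.symm.toContinuousLinearEquiv.toContinuousLinearMap) (fun x => by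
      have h1 : inner ℂ x (U (S.adjoint (S (U.symm x)))) =
          inner ℂ (S (U.symm x)) (S (U.symm x)) := by
        rw [← ContinuousLinearMap.adjoint_inner_right, ← U.inner_map_map, U.apply_symm_apply]
      exact (zero_le_inner_self _).trans_eq h1.symm) fun a x => by
    change U (S.adjoint (S (U.symm _))) = f.gnsNonUnitalStarAlgHom a (U (S.adjoint (S (U.symm x))))
    rw [hUs, hSi, hadj, hU]
  refine ⟨t, apply_eq_mul_of_star_mul fun a b => ?_⟩
  have h1 : S.adjoint (S (gnsVec φ b)) = t • gnsVec φ b := by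
    apply U.injective
    have := ht (U (gnsVec φ b))
    rw [map_smul, ← this]
    simp
  rw [← inner_gnsVec, ← inner_gnsVec, ← inner_smul_right, ← h1,
    ContinuousLinearMap.adjoint_inner_right, hS, hS]

end Pure

/-! ### Extreme points of compact convex sets -/

/-- **Milman's theorem**: an extreme point of a compact convex set `C` lying in the closed convex
hull of a subset `V` of `C` lies in the closure of `V`. -/
theorem mem_closure_of_mem_extremePoints {E : Type*} [AddCommGroup E] [Module ℝ E]
    [TopologicalSpace E] [IsTopologicalAddGroup E] [ContinuousSMul ℝ E] [T2Space E]
    [LocallyConvexSpace ℝ E] {C V : Set E} (hC : IsCompact C) (hCc : Convex ℝ C) {x : E}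
    (hx : x ∈ C.extremePoints ℝ) (hVC : V ⊆ C) (hxV : x ∈ closure (convexHull ℝ V)) :
    x ∈ closure V := by
  by_contra hxn
  have hclC : closure V ⊆ C := closure_minimal hVC hC.isClosed
  -- `closure V` is covered by finitely many half-spaces missing `x`. The convex hull `D` of the
  -- corresponding pieces of `C` is compact, and misses `x` because `x` is extreme.
  obtain ⟨D, hD, hDc, hDC, hxD, hVD⟩ : ∃ D : Set E, IsCompact D ∧ Convex ℝ D ∧ D ⊆ C ∧ x ∉ D ∧
      closure V ⊆ D := by
    refine (hC.of_isClosed_subset isClosed_closure hclC).induction_on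
      (p := fun s => ∃ D : Set E, IsCompact D ∧ Convex ℝ D ∧ D ⊆ C ∧ x ∉ D ∧ s ⊆ D)
      ⟨∅, isCompact_empty, convex_empty, Set.empty_subset _, Set.notMem_empty _,
        Set.empty_subset _⟩ ?_ ?_ ?_
    · rintro s t hst ⟨D, h1, h2, h3, h4, h5⟩
      exact ⟨D, h1, h2, h3, h4, hst.trans h5⟩
    · rintro s t ⟨D, h1, h2, h3, h4, h5⟩ ⟨D', h1', h2', h3', h4', h5'⟩
      rcases D.eq_empty_or_nonempty with rfl | hne
      · exact ⟨D', h1', h2', h3', h4', Set.union_subset (h5.trans (Set.empty_subset _)) h5'⟩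
      rcases D'.eq_empty_or_nonempty with rfl | hne'
      · exact ⟨D, h1, h2, h3, h4, Set.union_subset h5 (h5'.trans (Set.empty_subset _))⟩
      refine ⟨convexJoin ℝ D D', ?_, h2.convexJoin h2', convexJoin_subset h3 h3' hCc, ?_,
        Set.union_subset (h5.trans (subset_convexJoin_left hne'))
          (h5'.trans (subset_convexJoin_right hne))⟩
      · have himage : convexJoin ℝ D D' =
            (fun p : ℝ × E × E => (1 - p.1) • p.2.1 + p.1 • p.2.2) ''
              (Set.Icc 0 1 ×ˢ D ×ˢ D') := by
          ext y
          simp only [mem_convexJoin, segment_eq_image, Set.mem_image, Set.mem_prod, Prod.exists]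
          constructor
          · rintro ⟨a, ha, b, hb, t, ht, rfl⟩
            exact ⟨t, a, b, ⟨ht, ha, hb⟩, rfl⟩
          · rintro ⟨t, a, b, ⟨ht, ha, hb⟩, rfl⟩
            exact ⟨a, ha, b, hb, t, ht, rfl⟩
        rw [himage]
        exact (isCompact_Icc.prod (h1.prod h1')).image (by fun_prop)
      · rintro hmem
        obtain ⟨a, ha, b, hb, hseg⟩ := mem_convexJoin.1 hmem
        have hax : x ≠ a := fun h => h4 (h ▸ ha)
        have hbx : x ≠ b := fun h => h4' (h ▸ hb)
        exact hax ((mem_extremePoints.1 hx).2 a (h3 ha) b (h3' hb)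
          (mem_openSegment_of_ne_left_right hax.symm hbx.symm hseg)).1.symm
    · intro y hy
      have hyx : y ≠ x := fun h => hxn (h ▸ hy)
      obtain ⟨f, hf⟩ := geometric_hahn_banach_point_point hyx
      obtain ⟨c, hyc, hcx⟩ := exists_between hf
      refine ⟨closure V ∩ {z | f z ≤ c}, ?_, C ∩ {z | f z ≤ c}, ?_, ?_, Set.inter_subset_left,
        fun h => h.2.not_gt hcx, Set.inter_subset_inter_left _ hclC⟩
      · exact Filter.inter_mem self_mem_nhdsWithin (mem_nhdsWithin_of_mem_nhds
          ((f.continuous.tendsto y).eventually_le_const hyc))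
      · exact hC.inter_right (isClosed_le f.continuous continuous_const)
      · exact hCc.inter (convex_halfSpace_le f.toLinearMap.isLinear c)
  exact hxD (closure_minimal (convexHull_min (subset_closure.trans hVD) hDc) hD.isClosed hxV)

/-- A point of a compact convex set which is extreme, and which no continuous functional separates
from a subset `V`, lies in the closure of `V`. -/
theorem mem_closure_of_mem_extremePoints_of_forall_re_le {E : Type*} [AddCommGroup E] [Module ℝ E]
    [Module ℂ E] [IsScalarTower ℝ ℂ E] [TopologicalSpace E] [IsTopologicalAddGroup E]
    [ContinuousSMul ℂ E] [T2Space E] [LocallyConvexSpace ℝ E] {C V : Set E} (hC : IsCompact C)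
    (hCc : Convex ℝ C) {x : E} (hx : x ∈ C.extremePoints ℝ) (hVC : V ⊆ C)
    (h : ∀ (ℓ : StrongDual ℂ E) (s : ℝ), (∀ v ∈ V, (ℓ v).re ≤ s) → (ℓ x).re ≤ s) :
    x ∈ closure V := by
  have : ContinuousSMul ℝ E := IsScalarTower.continuousSMul ℂ
  refine mem_closure_of_mem_extremePoints hC hCc hx hVC ?_
  by_contra hn
  obtain ⟨ℓ, s, hℓ, hs⟩ := RCLike.geometric_hahn_banach_closed_point (𝕜 := ℂ)
    (convex_convexHull ℝ V).closure isClosed_closure hn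
  exact hs.not_ge (h ℓ s fun v hv =>
    (hℓ v (subset_closure (subset_convexHull ℝ V hv))).le)

/-! ### Approximation by vector states -/

section Approximation

variable {A : Type u} [NonUnitalCStarAlgebra A] [PartialOrder A]

variable (A) in
/-- The positive functionals of norm at most one, in the weak-* topology. -/
def quasiStateSpace : Set (WeakDual ℂ A) :=
  {h | (∀ a : A, 0 ≤ a → 0 ≤ h a) ∧ ‖WeakDual.toStrongDual h‖ ≤ 1}

theorem isCompact_quasiStateSpace : IsCompact (quasiStateSpace A) := by
  have h1 := WeakDual.isCompact_closedBall (𝕜 := ℂ) (0 : StrongDual ℂ A) 1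
  have h2 : IsClosed {h : WeakDual ℂ A | ∀ a : A, 0 ≤ a → 0 ≤ h a} := by
    have : {h : WeakDual ℂ A | ∀ a : A, 0 ≤ a → 0 ≤ h a} =
        ⋂ (a : A) (_ : 0 ≤ a), {h : WeakDual ℂ A | 0 ≤ h a} := by
      ext; simp
    rw [this]
    exact isClosed_biInter fun a _ => isClosed_le continuous_const (WeakDual.eval_continuous a)
  convert h1.inter_left h2 using 1
  ext h
  simp [quasiStateSpace]

variable [StarOrderedRing A]

theorem apply_eq_zero_of_mem_gnsKer {f : A →ₚ[ℂ] ℂ} {a : A} (ha : a ∈ gnsKer f) : f a = 0 := by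
  obtain ⟨Ω, hΩ, hΩ'⟩ := exists_cyclic_vector f
  have ha' : f.gnsNonUnitalStarAlgHom a = 0 := ha
  rw [← hΩ', ← hΩ, ha', _root_.zero_apply, inner_zero_right]

theorem re_apply_realPart (f : A →ₚ[ℂ] ℂ) (a : A) :
    (f (realPart a : A)).re = (f a).re := by
  have h : f (star a) = star (f a) := map_star f a
  have h2 : f ((2⁻¹ : ℝ) • (a + star a)) = (2⁻¹ : ℝ) • (f (a + star a)) :=
    f.map_smul_of_tower _ _
  rw [realPart_apply_coe, h2, map_add, h, Complex.smul_re, Complex.add_re, Complex.star_def,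
    Complex.conj_re, smul_eq_mul]
  ring

/-- If `π_f` and `π_g` have the same kernel, an upper bound of `a` on the vector functionals of `f`
is an upper bound on `g`: the positive part of `Re a - s` lies in the kernel. -/
theorem re_apply_le_of_vectorFunctional_le {f g : A →ₚ[ℂ] ℂ} (hg : ‖toDual g‖ ≤ 1)
    (hfg : gnsKer f = gnsKer g) {a : A} {s : ℝ}
    (h : ∀ ξ : f.GNS, ‖ξ‖ ≤ 1 → (vectorFunctional f ξ a).re ≤ s) : (g a).re ≤ s := by
  have hs : 0 ≤ s := by simpa [vectorFunctional_apply] using h 0 (by simp)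
  set b : A := (realPart a : A) with hb
  have hbsa : IsSelfAdjoint b := (realPart a).2
  rw [← re_apply_realPart g, ← hb]
  have h' : ∀ ξ : f.GNS, (vectorFunctional f ξ b).re ≤ s * ‖ξ‖ ^ 2 := by
    intro ξ
    rcases eq_or_ne ξ 0 with rfl | hξ
    · simp [vectorFunctional_apply]
    have hn : 0 < ‖ξ‖ := norm_pos_iff.2 hξ
    have h1 := h ((‖ξ‖⁻¹ : ℂ) • ξ) (by
      rw [norm_smul, norm_inv, Complex.norm_real, norm_norm, inv_mul_cancel₀ hn.ne'])
    rw [← re_apply_realPart, ← hb, vectorFunctional_apply, map_smul, inner_smul_left,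
      inner_smul_right, ← vectorFunctional_apply, ← Complex.ofReal_inv, Complex.conj_ofReal,
      Complex.re_ofReal_mul, Complex.re_ofReal_mul] at h1
    field_simp at h1
    exact h1.trans_eq (mul_comm _ _)
  -- `π_f b ≤ s`
  have hspec : ∀ x ∈ quasispectrum ℝ (f.gnsNonUnitalStarAlgHom b), x ≤ s := by
    have hsa : IsSelfAdjoint (f.gnsNonUnitalStarAlgHom b) := hbsa.map _
    have hle : f.gnsNonUnitalStarAlgHom b ≤ algebraMap ℝ (f.GNS →L[ℂ] f.GNS) s := by
      rw [ContinuousLinearMap.le_def, ContinuousLinearMap.isPositive_def]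
      refine ⟨((IsSelfAdjoint.algebraMap _ (IsSelfAdjoint.all s)).sub hsa).isSymmetric,
        fun x => ?_⟩
      have h1 := h' x
      have h2 : ((algebraMap ℝ (f.GNS →L[ℂ] f.GNS)) s - f.gnsNonUnitalStarAlgHom b) x
          = (s : ℂ) • x - f.gnsNonUnitalStarAlgHom b x := by
        rw [sub_apply, Algebra.algebraMap_eq_smul_one]
        rfl
      rw [ContinuousLinearMap.reApplyInnerSelf_apply, ← inner_re_symm, h2, inner_sub_right,
        inner_smul_right, inner_self_eq_norm_sq_to_K, ← vectorFunctional_apply, map_sub,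
        sub_nonneg]
      have h3 : ((s : ℂ) * (‖x‖ : ℂ) ^ 2).re = s * ‖x‖ ^ 2 := by
        rw [← Complex.ofReal_pow, Complex.re_ofReal_mul, Complex.ofReal_re]
      exact h1.trans_eq h3.symm
    intro x hx
    rw [quasispectrum_eq_spectrum_union_zero] at hx
    rcases hx with hx | hx
    · exact (le_algebraMap_iff_spectrum_le hsa).1 hle x hx
    · rw [Set.mem_singleton_iff.1 hx]; exact hs
  set F : ℝ → ℝ := fun t => max (t - s) 0 with hF
  set G : ℝ → ℝ := fun t => max (min t s) 0 with hG
  have hF0 : F 0 = 0 := by simp [hF, hs]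
  have hG0 : G 0 = 0 := by simp [hG, hs]
  have hFc : Continuous F := by fun_prop
  have hGc : Continuous G := by fun_prop
  have hker : cfcₙ F b ∈ gnsKer g := by
    rw [← hfg]
    change f.gnsNonUnitalStarAlgHom (cfcₙ F b) = 0
    rw [NonUnitalStarAlgHomClass.map_cfcₙ (S := ℂ) f.gnsNonUnitalStarAlgHom F b
      hFc.continuousOn hF0 (map_continuous _) hbsa (hbsa.map _), ← cfcₙ_zero ℝ]
    refine cfcₙ_congr fun x hx => ?_
    simp [hF, hspec x hx]
  have hbnd : b ≤ cfcₙ F b + cfcₙ G b := by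
    rw [← cfcₙ_add F G b hFc.continuousOn hF0 hGc.continuousOn hG0]
    conv_lhs => rw [← cfcₙ_id ℝ b hbsa]
    refine cfcₙ_mono (fun x _ => ?_) (by fun_prop) (by fun_prop) rfl (by simp [hF0, hG0])
    simp only [hF, hG, id]
    rcases le_total x s with h1 | h1
    · rw [min_eq_left h1]
      exact (le_max_left _ _).trans (le_add_of_nonneg_left (le_max_right _ _))
    · rw [min_eq_right h1]
      linarith [le_max_left (x - s) 0, le_max_left s 0]
  have hnorm : ‖cfcₙ G b‖ ≤ s := by
    refine norm_cfcₙ_le fun x _ => ?_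
    rw [Real.norm_of_nonneg (le_max_right _ _)]
    exact max_le (min_le_right _ _) hs
  have h1 : g b ≤ g (cfcₙ G b) := by
    have := OrderHomClass.mono g hbnd
    rwa [map_add, apply_eq_zero_of_mem_gnsKer hker, zero_add] at this
  calc (g b).re ≤ (g (cfcₙ G b)).re := (Complex.le_def.1 h1).1
    _ ≤ ‖toDual g (cfcₙ G b)‖ := Complex.re_le_norm _
    _ ≤ 1 * s := (toDual g).le_of_opNorm_le_of_le hg hnorm
    _ = s := one_mul s

/-- Milman's theorem in the quasi-state space: a pure state which no element of `A` separates from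
a set `V` of quasi-states is in the weak-* closure of `V`. -/
theorem IsPureState.mem_closure_of_forall_re_le {f : A →ₚ[ℂ] ℂ} (hf : IsPureState f)
    {V : Set (WeakDual ℂ A)} (hV : V ⊆ quasiStateSpace A)
    (h : ∀ (a : A) (s : ℝ), (∀ v ∈ V, (v a).re ≤ s) → (f a).re ≤ s) :
    StrongDual.toWeakDual (toDual f) ∈ closure V := by
  -- The weak dual carries two instances of a real module structure; this fixes the pointwise one.
  let _ : Module ℝ (WeakDual ℂ A) := WeakDual.instModule' ℝ
  have : IsScalarTower ℝ ℂ (WeakDual ℂ A) :=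
    ⟨fun r c h => DFunLike.ext _ _ fun x => smul_assoc r c (h x)⟩
  have : ContinuousSMul ℝ (WeakDual ℂ A) := IsScalarTower.continuousSMul ℂ
  have : LocallyConvexSpace ℝ (WeakDual ℂ A) :=
    (WeakDual.withSeminorms ℂ A).toLocallyConvexSpace
  refine mem_closure_of_mem_extremePoints_of_forall_re_le isCompact_quasiStateSpace ?_ ?_ hV ?_
  · rintro h ⟨h1, h2⟩ k ⟨k1, k2⟩ s t hs ht hst
    refine ⟨fun a ha => add_nonneg (smul_nonneg hs (h1 a ha)) (smul_nonneg ht (k1 a ha)), ?_⟩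
    have := convex_closedBall (0 : StrongDual ℂ A) 1 (mem_closedBall_zero_iff.2 h2)
      (mem_closedBall_zero_iff.2 k2) hs ht hst
    exact mem_closedBall_zero_iff.1 this
  · obtain ⟨hfs, hext⟩ := mem_extremePoints_iff_left.1 hf
    refine mem_extremePoints_iff_left.2 ⟨⟨hfs.1, hfs.2.le⟩, ?_⟩
    rintro h ⟨h1, h2⟩ k ⟨k1, k2⟩ ⟨s, t, hs, ht, hst, hsum⟩
    have hsum' : s • WeakDual.toStrongDual h + t • WeakDual.toStrongDual k = toDual f := hsum
    have hn : 1 ≤ s * ‖WeakDual.toStrongDual h‖ + t * ‖WeakDual.toStrongDual k‖ := by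
      rw [← hfs.2, ← hsum']
      refine (norm_add_le _ _).trans_eq ?_
      rw [norm_smul, norm_smul, Real.norm_of_nonneg hs.le, Real.norm_of_nonneg ht.le]
    have hn1 : ‖WeakDual.toStrongDual h‖ = 1 := by nlinarith
    have hn2 : ‖WeakDual.toStrongDual k‖ = 1 := by nlinarith
    exact hext _ ⟨h1, hn1⟩ _ ⟨k1, hn2⟩ ⟨s, t, hs, ht, hst, hsum'⟩
  · intro ℓ s hs
    obtain ⟨a, rfl⟩ := LinearMap.dualEmbedding_surjective (topDualPairing ℂ A) ℓ
    exact h a s hs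

theorem norm_vectorFunctional_sub_normalize_le (f : A →ₚ[ℂ] ℂ) {ξ : f.GNS} (hξ : ‖ξ‖ ≤ 1)
    (hξ0 : ξ ≠ 0) (a : A) :
    ‖vectorFunctional f ((‖ξ‖⁻¹ : ℂ) • ξ) a - vectorFunctional f ξ a‖ ≤
      (1 - ‖ξ‖ ^ 2) * ‖a‖ := by
  have hn : 0 < ‖ξ‖ := norm_pos_iff.2 hξ0
  have hn' : (‖ξ‖ : ℂ) ≠ 0 := Complex.ofReal_ne_zero.2 hn.ne'
  have h1 : vectorFunctional f ξ a =
      ((‖ξ‖ ^ 2 : ℝ) : ℂ) * vectorFunctional f ((‖ξ‖⁻¹ : ℂ) • ξ) a := by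
    rw [vectorFunctional_apply, vectorFunctional_apply, map_smul, inner_smul_left,
      inner_smul_right, ← Complex.ofReal_inv, Complex.conj_ofReal]
    push_cast
    field_simp
  have h2 : ‖vectorFunctional f ((‖ξ‖⁻¹ : ℂ) • ξ) a‖ ≤ ‖a‖ := by
    refine ((toDual (vectorFunctional f ((‖ξ‖⁻¹ : ℂ) • ξ))).le_opNorm a).trans_eq ?_
    rw [norm_vectorFunctional, norm_smul, norm_inv, Complex.norm_real, norm_norm,
      inv_mul_cancel₀ hn.ne', one_pow, one_mul]
  have h3 : 0 ≤ 1 - ‖ξ‖ ^ 2 := by nlinarith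
  rw [h1, ← one_sub_mul, norm_mul, ← Complex.ofReal_one, ← Complex.ofReal_sub,
    Complex.norm_real, Real.norm_of_nonneg h3]
  gcongr

/-- A pure state is a weak-* limit of vector states of any pure state whose GNS representation has
the same kernel. -/
theorem IsPureState.exists_vectorFunctional_near {f g : A →ₚ[ℂ] ℂ} (hg : IsPureState g)
    (hfg : gnsKer f = gnsKer g) (G : Finset A) {δ : ℝ} (hδ : 0 < δ) :
    ∃ ξ : f.GNS, ‖ξ‖ = 1 ∧ ∀ x ∈ G, ‖vectorFunctional f ξ x - g x‖ < δ := by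
  classical
  have hgs := (extremePoints_subset hg).2
  set V : Set (WeakDual ℂ A) :=
    {h | ∃ ξ : f.GNS, ‖ξ‖ ≤ 1 ∧ h = StrongDual.toWeakDual (toDual (vectorFunctional f ξ))} with hV
  have hVC : V ⊆ quasiStateSpace A := by
    rintro _ ⟨ξ, hξ, rfl⟩
    refine ⟨fun a ha => (vectorFunctional f ξ).map_nonneg ha, ?_⟩
    change ‖toDual (vectorFunctional f ξ)‖ ≤ 1
    rw [norm_vectorFunctional]
    exact pow_le_one₀ (norm_nonneg _) hξ
  have hcl := hg.mem_closure_of_forall_re_le hVC fun a s hs =>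
    re_apply_le_of_vectorFunctional_le hgs.le hfg fun ξ hξ => hs _ ⟨ξ, hξ, rfl⟩
  set M : ℝ := ∑ x ∈ G, ‖x‖ with hM
  have hM0 : 0 ≤ M := Finset.sum_nonneg fun _ _ => norm_nonneg _
  set η : ℝ := min (1 / 4) (δ / (1 + 2 * M)) with hη
  have hη0 : 0 < η := by positivity
  -- closeness on an element `a₀` nearly attaining `‖g‖ = 1` forces `‖ξ‖` to be nearly one
  obtain ⟨a₀, ha₀, ha₀'⟩ := (toDual g).exists_lt_apply_of_lt_opNorm
    (show 1 - η < ‖toDual g‖ by rw [hgs]; linarith)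
  obtain ⟨_, hnear, ξ, hξ, rfl⟩ := mem_closure_iff.1 hcl
    (⋂ x ∈ insert a₀ G, {h : WeakDual ℂ A | ‖h x - g x‖ < η})
    (isOpen_biInter_finset fun x _ => isOpen_lt
      (((WeakDual.eval_continuous x).sub continuous_const).norm) continuous_const)
    (by simp only [Set.mem_iInter]
        intro x _
        change ‖g x - g x‖ < η
        rwa [sub_self, norm_zero])
  simp only [Set.mem_iInter] at hnear
  have hnear' : ∀ x ∈ insert a₀ G, ‖vectorFunctional f ξ x - g x‖ < η := hnear
  have hξ2 : 1 - 2 * η < ‖ξ‖ ^ 2 := by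
    have h1 := hnear' a₀ (Finset.mem_insert_self _ _)
    have h2 : ‖vectorFunctional f ξ a₀‖ ≤ ‖ξ‖ ^ 2 * 1 := by
      rw [← norm_vectorFunctional]
      exact (toDual (vectorFunctional f ξ)).le_opNorm_of_le ha₀.le
    have h3 := norm_sub_norm_le (g a₀) (vectorFunctional f ξ a₀)
    rw [norm_sub_rev] at h3
    rw [toDual_apply] at ha₀'
    linarith
  have hξ0 : ξ ≠ 0 := by
    rintro rfl
    rw [norm_zero] at hξ2
    have := min_le_left (1 / 4 : ℝ) (δ / (1 + 2 * M))
    norm_num at hξ2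
    linarith
  refine ⟨(‖ξ‖⁻¹ : ℂ) • ξ, ?_, fun x hx => ?_⟩
  · rw [norm_smul, norm_inv, Complex.norm_real, norm_norm,
      inv_mul_cancel₀ (norm_ne_zero_iff.2 hξ0)]
  · have h1 := norm_vectorFunctional_sub_normalize_le f hξ hξ0 x
    have h2 := hnear' x (Finset.mem_insert_of_mem hx)
    have h3 : ‖x‖ ≤ M := Finset.single_le_sum (f := fun x => ‖x‖) (fun _ _ => norm_nonneg _) hx
    have h4 : η * (1 + 2 * M) ≤ δ :=
      (le_div_iff₀ (by positivity)).1 (min_le_right _ _)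
    have h5 : (1 - ‖ξ‖ ^ 2) * ‖x‖ ≤ 2 * η * M := by
      apply mul_le_mul (by linarith) h3 (norm_nonneg _) (by positivity)
    have h6 := norm_sub_le_norm_sub_add_norm_sub
      (vectorFunctional f ((‖ξ‖⁻¹ : ℂ) • ξ) x) (vectorFunctional f ξ x) (g x)
    linarith

end Approximation

/-! ### Inner automorphisms and transitivity on vector states -/

section Inner

variable {A : Type*} [NonUnitalCStarAlgebra A]

theorem Ad_mul_apply (u v : unitary A⁺¹) (x : A) : Ad (u * v) x = Ad u (Ad v x) := by
  apply Unitization.inr_injective (R := ℂ)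
  simp only [inr_Ad]
  simp [mul_assoc]

@[simp] theorem Ad_one_apply (x : A) : Ad (1 : unitary A⁺¹) x = x := by
  apply Unitization.inr_injective (R := ℂ)
  simp [inr_Ad]

@[simp] theorem Ad_Ad_inv_apply (u : unitary A⁺¹) (x : A) : Ad u (Ad u⁻¹ x) = x := by
  rw [← Ad_mul_apply, mul_inv_cancel, Ad_one_apply]

@[simp] theorem Ad_inv_Ad_apply (u : unitary A⁺¹) (x : A) : Ad u⁻¹ (Ad u x) = x := by
  rw [← Ad_mul_apply, inv_mul_cancel, Ad_one_apply]

theorem norm_starAlgEquiv_apply (α : A ≃⋆ₐ[ℂ] A) (x : A) : ‖α x‖ = ‖x‖ :=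
  NonUnitalStarAlgHom.norm_map α α.injective x

theorem norm_starAlgEquiv_sub (α : A ≃⋆ₐ[ℂ] A) (x y : A) : ‖α x - α y‖ = ‖x - y‖ := by
  rw [← map_sub, norm_starAlgEquiv_apply]

end Inner

section VectorStates

variable {A : Type u} [NonUnitalCStarAlgebra A] [PartialOrder A] [StarOrderedRing A]

theorem IsPureState.exists_eq_vectorFunctional {f : A →ₚ[ℂ] ℂ} (hf : IsPureState f) :
    ∃ Ω : f.GNS, ‖Ω‖ = 1 ∧ vectorFunctional f Ω = f := by
  obtain ⟨Ω, hΩ, hΩ'⟩ := exists_cyclic_vector f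
  have h : vectorFunctional f Ω = f := by
    ext a
    rw [vectorFunctional_apply, hΩ, hΩ']
  refine ⟨Ω, ?_, h⟩
  rw [← sq_eq_sq₀ (norm_nonneg _) zero_le_one, ← norm_vectorFunctional, h,
    (extremePoints_subset hf).2, one_pow]

theorem vectorFunctional_smul (f : A →ₚ[ℂ] ℂ) {c : ℂ} (hc : ‖c‖ = 1) (ξ : f.GNS) :
    vectorFunctional f (c • ξ) = vectorFunctional f ξ := by
  ext a
  rw [vectorFunctional_apply, map_smul, inner_smul_left, inner_smul_right, ← mul_assoc,
    Complex.conj_mul', hc, Complex.ofReal_one, one_pow, one_mul, vectorFunctional_apply]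

theorem exists_norm_eq_one_zero_le_re_mul (z : ℂ) : ∃ c : ℂ, ‖c‖ = 1 ∧ 0 ≤ (c * z).re := by
  rcases le_total 0 z.re with h | h
  · exact ⟨1, norm_one, by simpa using h⟩
  · exact ⟨-1, by simp, by simpa using h⟩

theorem line_ne_zero {H : Type*} [NormedAddCommGroup H] [InnerProductSpace ℂ H] {x y : H}
    (hx : ‖x‖ = 1) (hy : ‖y‖ = 1) (hxy : 0 ≤ (inner ℂ x y).re) (t : ℝ) :
    (1 - t : ℂ) • x + (t : ℂ) • y ≠ 0 := by
  intro h0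
  have h1 : ((1 - t : ℂ) • x) = ((1 - t : ℝ) : ℂ) • x := by push_cast; rfl
  have h : ‖(1 - t : ℂ) • x + (t : ℂ) • y‖ ^ 2 =
      (1 - t) ^ 2 + 2 * ((1 - t) * (t * (inner ℂ x y).re)) + t ^ 2 := by
    rw [norm_add_sq (𝕜 := ℂ), h1, inner_smul_left, inner_smul_right, norm_smul, norm_smul, hx, hy,
      Complex.norm_real, Complex.norm_real, Complex.conj_ofReal]
    simp only [mul_one, Real.norm_eq_abs, sq_abs, RCLike.re_eq_complex_re, Complex.re_ofReal_mul]
  have hle : (inner ℂ x y).re ≤ 1 := by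
    refine (Complex.re_le_norm _).trans ((norm_inner_le_norm x y).trans ?_)
    rw [hx, hy, one_mul]
  rw [h0, norm_zero] at h
  nlinarith [sq_nonneg (1 - 2 * t), mul_nonneg hxy (sq_nonneg (1 - 2 * t)),
    mul_nonneg (sub_nonneg.2 hle) (sq_nonneg (1 - 2 * t))]

/-- A substitute for Kadison's transitivity theorem: as any two families of unit vectors are joined
by a path, property (S) makes any two families of vector states of mutually disjoint pure states
conjugate under a single unitary. -/
theorem StrongTransitivityProperty.exists_unitary_vectorFunctional
    (hA : StrongTransitivityProperty A) {n : ℕ} {f : Fin n → (A →ₚ[ℂ] ℂ)}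
    (hf : ∀ i, IsPureState (f i)) (hdisj : ∀ i j, i ≠ j → StateDisjoint (f i) (f j))
    (ξ η : ∀ i, (f i).GNS) (hξ : ∀ i, ‖ξ i‖ = 1) (hη : ∀ i, ‖η i‖ = 1) :
    ∃ v ∈ unitaryGroup A, ∀ i, ∀ b : A,
      vectorFunctional (f i) (ξ i) b = vectorFunctional (f i) (η i) (Ad v b) := by
  choose c hc hre using fun i => exists_norm_eq_one_zero_le_re_mul (inner ℂ (ξ i) (η i))
  let γ : ∀ i, ℝ → (f i).GNS := fun i t => (1 - t : ℂ) • ξ i + (t : ℂ) • c i • η i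
  have hγ0 : ∀ i t, γ i t ≠ 0 := fun i t =>
    line_ne_zero (hξ i) (by rw [norm_smul, hc, hη, one_mul])
      (by rw [inner_smul_right]; exact hre i) t
  have hγc : ∀ i, Continuous (γ i) := fun i =>
    ((continuous_const.sub Complex.continuous_ofReal).smul continuous_const).add
      (Complex.continuous_ofReal.smul continuous_const)
  let ζ : ∀ i, ℝ → (f i).GNS := fun i t => ((‖γ i t‖⁻¹ : ℝ) : ℂ) • γ i t
  have hζ1 : ∀ i t, ‖ζ i t‖ = 1 := fun i t => by
    simp only [ζ]
    rw [norm_smul, Complex.norm_real, norm_inv, norm_norm,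
      inv_mul_cancel₀ (norm_ne_zero_iff.2 (hγ0 i t))]
  have hζc : ∀ i, Continuous (ζ i) := fun i =>
    (Complex.continuous_ofReal.comp
      ((hγc i).norm.inv₀ fun t => norm_ne_zero_iff.2 (hγ0 i t))).smul (hγc i)
  obtain ⟨G, δ, hδ, hS⟩ := hA ∅ 1 one_pos
  have hequiv : ∀ i t, StateEquivalent (vectorFunctional (f i) (ζ i t)) (f i) := fun i t =>
    (hf i).vectorFunctional_equivalent (hζ1 i t)
  have key : ∃ v ∈ unitaryGroup A, ∀ i, ∀ b : A,
      vectorFunctional (f i) (ζ i 0) b = vectorFunctional (f i) (ζ i 1) (Ad v b) := by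
    refine isPreconnected_univ.induction₂ (fun s t => ∃ v ∈ unitaryGroup A, ∀ i, ∀ b : A,
      vectorFunctional (f i) (ζ i s) b = vectorFunctional (f i) (ζ i t) (Ad v b)) ?_ ?_ ?_
      (Set.mem_univ 0) (Set.mem_univ 1)
    · intro s _
      rw [nhdsWithin_univ]
      have hev : ∀ i, ∀ x ∈ G, ∀ᶠ t in 𝓝 s,
          ‖vectorFunctional (f i) (ζ i s) x - vectorFunctional (f i) (ζ i t) x‖ < δ := by
        intro i x _
        have hcont : Continuous fun t =>
            ‖vectorFunctional (f i) (ζ i s) x - vectorFunctional (f i) (ζ i t) x‖ := by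
          simp only [vectorFunctional_apply]
          exact (continuous_const.sub ((hζc i).inner
            (((f i).gnsNonUnitalStarAlgHom x).continuous.comp (hζc i)))).norm
        exact (hcont.tendsto s).eventually_lt_const (by rwa [sub_self, norm_zero])
      filter_upwards [eventually_all.2 fun i => (Finset.eventually_all G).2 (hev i)] with t ht
      obtain ⟨u, -, hu, -⟩ := hS A (NonUnitalStarAlgHom.id ℂ A) Function.injective_id n
        (fun i => vectorFunctional (f i) (ζ i s)) (fun i => vectorFunctional (f i) (ζ i t))
        (fun i => (hf i).isPureState_vectorFunctional (hζ1 i s))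
        (fun i => (hf i).isPureState_vectorFunctional (hζ1 i t))
        (fun i j hij => (hdisj i j hij).congr (hequiv i s) (hequiv j s))
        (fun i => (hequiv i s).trans (hequiv i t).symm) ht
      exact ⟨u 1, (u 1).2, hu⟩
    · rintro r s t - - - ⟨v, hv, h⟩ ⟨w, hw, h'⟩
      exact ⟨w * v, mul_mem hw hv, fun i b => by rw [h, h', Ad_mul_apply]⟩
    · rintro s t - - ⟨v, hv, h⟩
      exact ⟨v⁻¹, inv_mem hv, fun i b => by rw [h, Ad_Ad_inv_apply]⟩
  have h0 : ∀ i, ζ i 0 = ξ i := fun i => by simp [ζ, γ, hξ]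
  have h1 : ∀ i, ζ i 1 = c i • η i := fun i => by simp [ζ, γ, norm_smul, hc, hη]
  simpa only [h0, h1, vectorFunctional_smul _ (hc _)] using key

end VectorStates

/-! ### Concatenation of paths and limits of inner automorphisms -/

/-- Infinitely many paths in a topological group, starting at `1`, multiply up to a path on
`[0,∞)`. -/
theorem exists_continuous_concat {G : Type*} [Group G] [TopologicalSpace G] [ContinuousMul G]
    (u : ℕ → C(unitInterval, G)) (hu : ∀ n, u n 0 = 1) (c : ℕ → G)
    (hc : ∀ n, c (n + 1) = c n * u n 1) :
    ∃ w : ℝ → G, Continuous w ∧ (∀ n : ℕ, w n = c n) ∧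
      ∀ t : ℝ, 0 ≤ t → ∃ s, w t = c ⌊t⌋₊ * u ⌊t⌋₊ s := by
  -- `p N` is the product of the first `N` paths, the `n`-th one running over `[n, n+1]`.
  let p : ℕ → ℝ → G := fun N => Nat.rec (fun _ => c 0)
    (fun n q t => q t * u n (Set.projIcc 0 1 zero_le_one (t - n))) N
  have hp0 : ∀ t, p 0 t = c 0 := fun t => rfl
  have hp : ∀ n t, p (n + 1) t = p n t * u n (Set.projIcc 0 1 zero_le_one (t - n)) :=
    fun n t => rfl
  have hpc : ∀ N, Continuous (p N) := by
    intro N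
    induction N with
    | zero => exact continuous_const
    | succ n ih =>
      exact ih.mul ((u n).continuous.comp
        (continuous_projIcc.comp (continuous_id.sub continuous_const)))
  have hge : ∀ (N : ℕ) (t : ℝ), (N : ℝ) ≤ t → p N t = c N := by
    intro N
    induction N with
    | zero => exact fun t _ => hp0 t
    | succ n ih =>
      intro t ht
      push_cast at ht
      rw [hp, ih t (by linarith), Set.projIcc_of_right_le _ (by linarith), hc]
      rfl
  have hle : ∀ (N M : ℕ) (t : ℝ), t ≤ N → N ≤ M → p M t = p N t := by
    intro N M t ht hNM
    induction M, hNM using Nat.le_induction with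
    | base => rfl
    | succ m hm ih =>
      have hm' : (N : ℝ) ≤ m := by exact_mod_cast hm
      rw [hp, ih, Set.projIcc_of_le_left _ (by linarith)]
      exact (congrArg _ (hu m)).trans (mul_one _)
  refine ⟨fun t => p (⌊t⌋₊ + 1) t, ?_, fun n => ?_, fun t ht => ?_⟩
  · refine continuous_iff_continuousAt.2 fun t => ?_
    set N := ⌊t⌋₊ + 1
    refine ((hpc N).continuousAt (x := t)).congr ?_
    filter_upwards [eventually_lt_nhds (Nat.lt_floor_add_one t)] with s hs
    have hsN : s < (N : ℝ) := by push_cast [N]; exact hs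
    rcases lt_or_ge s 0 with h0 | h0
    · refine hle (⌊s⌋₊ + 1) N s ?_ (by
        rw [Nat.floor_of_nonpos h0.le]; exact Nat.succ_le_succ (Nat.zero_le _))
      push_cast
      linarith [Nat.cast_nonneg (α := ℝ) ⌊s⌋₊]
    · refine hle (⌊s⌋₊ + 1) N s ?_ (Nat.succ_le_of_lt ((Nat.floor_lt h0).2 hsN))
      push_cast
      exact (Nat.lt_floor_add_one s).le
  · simp only [Nat.floor_natCast]
    rw [hle n (n + 1) n le_rfl (Nat.le_succ n), hge n n le_rfl]
  · exact ⟨_, by dsimp only; rw [hp, hge _ t (Nat.floor_le ht)]⟩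

theorem exists_tendsto_of_geometric {X : Type*} [MetricSpace X] [CompleteSpace X] {w : ℝ → X}
    {z : ℕ → X} {j : ℕ} (hz : ∀ N, j ≤ N → dist (z N) (z (N + 1)) ≤ (1 / 2) ^ N)
    (hw : ∀ t : ℝ, 0 ≤ t → j ≤ ⌊t⌋₊ → dist (z ⌊t⌋₊) (w t) ≤ (1 / 2) ^ ⌊t⌋₊) :
    ∃ y, Filter.Tendsto w Filter.atTop (𝓝 y) := by
  have hcauchy : CauchySeq fun N => z (N + j) :=
    cauchySeq_of_le_geometric (1 / 2) ((1 / 2) ^ j) (by norm_num) fun N => by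
      have := hz (N + j) (Nat.le_add_left _ _)
      rw [pow_add, mul_comm] at this
      rwa [Nat.add_right_comm]
  obtain ⟨y, hy⟩ := cauchySeq_tendsto_of_complete hcauchy
  have hy' := (Filter.tendsto_add_atTop_iff_nat j).1 hy
  have hfl : Filter.Tendsto (fun t : ℝ => ⌊t⌋₊) Filter.atTop Filter.atTop :=
    tendsto_nat_floor_atTop
  refine ⟨y, tendsto_of_tendsto_of_dist (hy'.comp hfl) ?_⟩
  refine squeeze_zero' (Filter.Eventually.of_forall fun _ => dist_nonneg) ?_
    ((tendsto_pow_atTop_nhds_zero_of_lt_one (r := (1 / 2 : ℝ)) (by norm_num)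
      (by norm_num)).comp hfl)
  filter_upwards [Filter.eventually_ge_atTop 0, hfl.eventually_ge_atTop j] with t h0 hj
  exact hw t h0 hj

section Limit

variable {A : Type*} [NonUnitalCStarAlgebra A]

theorem exists_tendsto_of_dense {ι : Type*} {l : Filter ι} [l.NeBot] (θ : ι → A ≃⋆ₐ[ℂ] A)
    {D : Set A} (hD : Dense D) (h : ∀ x ∈ D, ∃ y, Tendsto (fun t => θ t x) l (𝓝 y)) (x : A) :
    ∃ y, Tendsto (fun t => θ t x) l (𝓝 y) := by
  refine cauchy_map_iff_exists_tendsto.1 (Metric.cauchy_iff.2 ⟨inferInstance, fun ε hε => ?_⟩)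
  obtain ⟨d, hd, hxd⟩ := hD.exists_dist_lt x (show 0 < ε / 4 by positivity)
  obtain ⟨y, hy⟩ := h d hd
  refine ⟨_, image_mem_map (Metric.tendsto_nhds.1 hy (ε / 4) (by positivity)), ?_⟩
  rintro _ ⟨s, hs, rfl⟩ _ ⟨t, ht, rfl⟩
  have hiso : ∀ r, dist (θ r x) (θ r d) = dist x d := fun r => by
    rw [dist_eq_norm, dist_eq_norm, norm_starAlgEquiv_sub]
  have hs' : dist (θ s d) y < ε / 4 := hs
  have ht' : dist (θ t d) y < ε / 4 := ht
  have h1 := dist_triangle4 (θ s x) (θ s d) (θ t d) (θ t x)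
  have h2 := dist_triangle_right (θ s d) (θ t d) y
  rw [hiso, dist_comm (θ t d), hiso] at h1
  linarith

/-- A net of automorphisms which converges pointwise on a dense set together with the inverses
converges pointwise to an automorphism. -/
theorem exists_starAlgEquiv_tendsto {ι : Type*} {l : Filter ι} [l.NeBot] (θ : ι → A ≃⋆ₐ[ℂ] A)
    {D : Set A} (hD : Dense D) (h : ∀ x ∈ D, ∃ y, Tendsto (fun t => θ t x) l (𝓝 y))
    (h' : ∀ x ∈ D, ∃ y, Tendsto (fun t => (θ t).symm x) l (𝓝 y)) :
    ∃ α : A ≃⋆ₐ[ℂ] A, (∀ x, Tendsto (fun t => θ t x) l (𝓝 (α x))) ∧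
      ∀ x, Tendsto (fun t => (θ t).symm x) l (𝓝 (α.symm x)) := by
  choose a ha using exists_tendsto_of_dense θ hD h
  choose b hb using exists_tendsto_of_dense (fun t => (θ t).symm) hD h'
  have key : ∀ (σ : ι → A ≃⋆ₐ[ℂ] A) (x y : A), Tendsto (fun t => (σ t).symm x) l (𝓝 y) →
      Tendsto (fun t => σ t y) l (𝓝 x) := by
    intro σ x y hxy
    refine tendsto_iff_norm_sub_tendsto_zero.2 ((tendsto_iff_norm_sub_tendsto_zero.1 hxy).congr
      fun t => ?_)
    rw [← norm_starAlgEquiv_sub (σ t), (σ t).apply_symm_apply, norm_sub_rev]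
  refine ⟨{ toFun := a
            invFun := b
            left_inv := fun x => tendsto_nhds_unique (hb (a x))
              (key (fun t => (θ t).symm) x (a x) (ha x))
            right_inv := fun x => tendsto_nhds_unique (ha (b x)) (key θ x (b x) (hb x))
            map_mul' := fun x y => tendsto_nhds_unique (ha (x * y)) (by
              simpa only [map_mul] using (ha x).mul (ha y))
            map_add' := fun x y => tendsto_nhds_unique (ha (x + y)) (by
              simpa only [map_add] using (ha x).add (ha y))
            map_star' := fun x => tendsto_nhds_unique (ha (star x)) (by
              simpa only [map_star] using (ha x).star)
            map_smul' := fun c x => tendsto_nhds_unique (ha (c • x)) (by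
              simpa only [map_smul] using (ha x).const_smul c) }, ha, hb⟩

theorem Ad_symm_apply (u : unitary A⁺¹) (x : A) : (Ad u).symm x = Ad u⁻¹ x := by
  rw [← Ad_inv_Ad_apply u ((Ad u).symm x), StarAlgEquiv.apply_symm_apply]

/-- An infinite product of paths of unitaries, each of which almost commutes with the given data,
converges to an automorphism. Convergence of the inverses is what makes the limit surjective, and
requires almost commutation with the elements `Ad (c N)⁻¹ (x j)` as well. -/
theorem exists_path_tendsto_automorphism {x : ℕ → A} (hx : DenseRange x)
    (v : ℕ → C(unitInterval, unitaryGroup A)) (hv : ∀ N, v N 0 = 1) (c : ℕ → unitaryGroup A)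
    (hc : ∀ N, c (N + 1) = c N * v N 1)
    (h : ∀ N j, j ≤ N → ∀ t, ‖Ad (v N t : unitary A⁺¹) (x j) - x j‖ ≤ (1 / 2) ^ N)
    (h' : ∀ N j, j ≤ N → ∀ t, ‖Ad (v N t : unitary A⁺¹) (Ad (c N : unitary A⁺¹)⁻¹ (x j)) -
      Ad (c N : unitary A⁺¹)⁻¹ (x j)‖ ≤ (1 / 2) ^ N) :
    ∃ (w : ℝ → unitaryGroup A) (α : A ≃⋆ₐ[ℂ] A), Continuous w ∧
      (∀ y, Tendsto (fun t => Ad (w t : unitary A⁺¹) y) atTop (𝓝 (α y))) ∧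
      (∀ y, Tendsto (fun t => Ad (w t : unitary A⁺¹)⁻¹ y) atTop (𝓝 (α.symm y))) ∧
      ∀ y, Tendsto (fun N => Ad (c N : unitary A⁺¹) y) atTop (𝓝 (α y)) := by
  obtain ⟨w, hwc, hwn, hw⟩ := exists_continuous_concat v hv c hc
  have hd : ∀ N j, j ≤ N → ∀ s,
      dist (Ad (c N : unitary A⁺¹) (x j)) (Ad ((c N * v N s : unitaryGroup A) : unitary A⁺¹) (x j))
        ≤ (1 / 2) ^ N := by
    intro N j hj s
    rw [Subgroup.coe_mul, Ad_mul_apply, dist_comm, dist_eq_norm, norm_starAlgEquiv_sub]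
    exact h N j hj s
  have hd' : ∀ N j, j ≤ N → ∀ s,
      dist (Ad (c N : unitary A⁺¹)⁻¹ (x j))
        (Ad ((c N * v N s : unitaryGroup A) : unitary A⁺¹)⁻¹ (x j)) ≤ (1 / 2) ^ N := by
    intro N j hj s
    rw [Subgroup.coe_mul, mul_inv_rev, Ad_mul_apply, dist_eq_norm,
      ← norm_starAlgEquiv_sub (Ad (v N s : unitary A⁺¹)), Ad_Ad_inv_apply]
    exact h' N j hj s
  obtain ⟨α, hα, hα'⟩ := exists_starAlgEquiv_tendsto (l := atTop)
    (fun t => Ad (w t : unitary A⁺¹)) hx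
    (by
      rintro _ ⟨j, rfl⟩
      refine exists_tendsto_of_geometric (z := fun N => Ad (c N : unitary A⁺¹) (x j)) (j := j)
        (fun N hN => ?_) fun t ht hj => ?_
      · rw [hc]; exact hd N j hN 1
      · obtain ⟨s, hs⟩ := hw t ht
        rw [hs]; exact hd _ j hj s)
    (by
      rintro _ ⟨j, rfl⟩
      simp only [Ad_symm_apply]
      refine exists_tendsto_of_geometric (z := fun N => Ad (c N : unitary A⁺¹)⁻¹ (x j)) (j := j)
        (fun N hN => ?_) fun t ht hj => ?_
      · rw [hc]; exact hd' N j hN 1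
      · obtain ⟨s, hs⟩ := hw t ht
        rw [hs]; exact hd' _ j hj s)
  refine ⟨w, α, hwc, hα, fun y => by simpa only [Ad_symm_apply] using hα' y, fun y => ?_⟩
  have := (hα y).comp tendsto_natCast_atTop_atTop
  simpa only [Function.comp_def, hwn] using this

end Limit

/-! ### The back-and-forth construction -/

section BackAndForth

variable {A : Type u} [NonUnitalCStarAlgebra A] [PartialOrder A] [StarOrderedRing A]

/-- Two tuples of mutually disjoint pure states whose GNS representations have pairwise the same
kernels. -/
structure KernelMatched {n : ℕ} (p q : Fin n → (A →ₚ[ℂ] ℂ)) : Prop where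
  pure_left : ∀ i, IsPureState (p i)
  pure_right : ∀ i, IsPureState (q i)
  disjoint_left : ∀ i j, i ≠ j → StateDisjoint (p i) (p j)
  disjoint_right : ∀ i j, i ≠ j → StateDisjoint (q i) (q j)
  gnsKer_eq : ∀ i, gnsKer (p i) = gnsKer (q i)

theorem KernelMatched.symm {n : ℕ} {p q : Fin n → (A →ₚ[ℂ] ℂ)} (h : KernelMatched p q) :
    KernelMatched q p :=
  ⟨h.pure_right, h.pure_left, h.disjoint_right, h.disjoint_left, fun i => (h.gnsKer_eq i).symm⟩

/-- The first tuple can be replaced by vector states of the same representations which are as close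
to the second tuple as desired. -/
theorem KernelMatched.exists_near {n : ℕ} {p q : Fin n → (A →ₚ[ℂ] ℂ)} (h : KernelMatched p q)
    (G : Finset A) {δ : ℝ} (hδ : 0 < δ) :
    ∃ ξ : ∀ i, (p i).GNS, (∀ i, ‖ξ i‖ = 1) ∧
      KernelMatched (fun i => vectorFunctional (p i) (ξ i)) q ∧
      ∀ i, ∀ x ∈ G, ‖vectorFunctional (p i) (ξ i) x - q i x‖ < δ := by
  choose ξ hξ hnear using fun i =>
    (h.pure_right i).exists_vectorFunctional_near (h.gnsKer_eq i) G hδ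
  have hequiv := fun i => (h.pure_left i).vectorFunctional_equivalent (hξ i)
  exact ⟨ξ, hξ, ⟨fun i => (h.pure_left i).isPureState_vectorFunctional (hξ i), h.pure_right,
    fun i j hij => (h.disjoint_left i j hij).congr (hequiv i) (hequiv j), h.disjoint_right,
    fun i => (hequiv i).gnsKer_eq.trans (h.gnsKer_eq i)⟩, hnear⟩

/-- One correction. The finite set `G` and the tolerance `δ` depend only on the data `(F, ε)` with
which the path has to commute, whereas `(G', δ')` prescribes freely how close the corrected tuple
comes to `q`. -/
theorem StrongTransitivityProperty.exists_controlled_path (hA : StrongTransitivityProperty A)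
    (F : Finset A) {ε : ℝ} (hε : 0 < ε) :
    ∃ (G : Finset A) (δ : ℝ), 0 < δ ∧ ∀ {n : ℕ} {p q : Fin n → (A →ₚ[ℂ] ℂ)},
      KernelMatched p q → (∀ i, ∀ x ∈ G, ‖p i x - q i x‖ < δ) →
      ∀ (G' : Finset A) {δ' : ℝ}, 0 < δ' →
        ∃ (p' : Fin n → (A →ₚ[ℂ] ℂ)) (u : C(unitInterval, unitaryGroup A)), u 0 = 1 ∧
          (∀ i, ∀ b : A, p' i b = p i (Ad (u 1 : unitary A⁺¹) b)) ∧
          (∀ x ∈ F, ∀ t, ‖Ad (u t : unitary A⁺¹) x - x‖ < ε) ∧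
          KernelMatched p' q ∧ ∀ i, ∀ x ∈ G', ‖p' i x - q i x‖ < δ' := by
  classical
  obtain ⟨G, δ, hδ, hS⟩ := hA F ε hε
  refine ⟨G, δ / 2, half_pos hδ, fun {n p q} hpq hclose G' {δ'} hδ' => ?_⟩
  obtain ⟨ξ, hξ, hm, hnear⟩ := hpq.exists_near (G ∪ G') (lt_min (half_pos hδ) hδ')
  obtain ⟨u, hu0, hu1, hu⟩ := hS A (NonUnitalStarAlgHom.id ℂ A) Function.injective_id n
    (fun i => vectorFunctional (p i) (ξ i)) p hm.pure_left hpq.pure_left hm.disjoint_left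
    (fun i => (hpq.pure_left i).vectorFunctional_equivalent (hξ i)) fun i x hx => by
      change ‖vectorFunctional (p i) (ξ i) x - p i x‖ < δ
      have h1 := (hnear i x (Finset.mem_union_left _ hx)).trans_le (min_le_left _ _)
      have h2 := hclose i x hx
      have h3 := norm_sub_le_norm_sub_add_norm_sub (vectorFunctional (p i) (ξ i) x) (q i x) (p i x)
      rw [norm_sub_rev (q i x)] at h3
      linarith
  exact ⟨_, u, hu0, hu1, hu, hm, fun i x hx =>
    (hnear i x (Finset.mem_union_right _ hx)).trans_le (min_le_right _ _)⟩

/-- The intertwining argument: the two tuples are corrected in turns, by unitaries `C m` for even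
and for odd `m` respectively, each correction `u m` being small on data that were fixed before the
preceding correction of the other tuple. -/
theorem StrongTransitivityProperty.exists_intertwining_sequence
    (hA : StrongTransitivityProperty A) (x : ℕ → A) {n : ℕ} {ω φ : Fin n → (A →ₚ[ℂ] ℂ)}
    (h : KernelMatched φ ω) :
    ∃ (P : ℕ → Fin n → (A →ₚ[ℂ] ℂ)) (C : ℕ → unitaryGroup A)
      (u : ℕ → C(unitInterval, unitaryGroup A)),
      (∀ m, u m 0 = 1) ∧ (∀ m, C (m + 2) = C m * u m 1) ∧
      (∀ i b, P 0 i b = φ i (Ad (C 0 : unitary A⁺¹) b)) ∧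
      (∀ i b, P 1 i b = ω i (Ad (C 1 : unitary A⁺¹) b)) ∧
      (∀ m i b, P (m + 2) i b = P m i (Ad (u m 1 : unitary A⁺¹) b)) ∧
      (∀ m j, j ≤ m → ∀ t, ‖Ad (u m t : unitary A⁺¹) (x j) - x j‖ ≤ (1 / 2) ^ m) ∧
      (∀ m j, j ≤ m → ∀ t, ‖Ad (u m t : unitary A⁺¹) (Ad (C m : unitary A⁺¹)⁻¹ (x j)) -
        Ad (C m : unitary A⁺¹)⁻¹ (x j)‖ ≤ (1 / 2) ^ m) ∧
      ∀ m j, j ≤ m → ∀ i, ‖P m i (x j) - P (m + 1) i (x j)‖ ≤ (1 / 2) ^ m := by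
  classical
  let F : ℕ → unitaryGroup A → Finset A := fun m c =>
    (Finset.range (m + 1)).image x ∪
      (Finset.range (m + 1)).image fun j => Ad (c : unitary A⁺¹)⁻¹ (x j)
  have hpow : ∀ m : ℕ, (0 : ℝ) < (1 / 2) ^ m := fun m => by positivity
  choose G δ hδ hstep using fun m c => hA.exists_controlled_path (F m c) (hpow m)
  let X : ℕ → Finset A := fun m => (Finset.range (m + 1)).image x
  -- A stage `((p, q), (a, b))` consists of the current tuples and unitaries, the first of which is
  -- to be corrected next.
  let Stage := ((Fin n → (A →ₚ[ℂ] ℂ)) × (Fin n → (A →ₚ[ℂ] ℂ))) × (unitaryGroup A × unitaryGroup A)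
  let Inv : ℕ → Stage → Prop := fun m s => KernelMatched s.1.1 s.1.2 ∧
    (∀ i, ∀ y ∈ G m s.2.1, ‖s.1.1 i y - s.1.2 i y‖ < δ m s.2.1) ∧
    ∀ i, ∀ y ∈ X m, ‖s.1.1 i y - s.1.2 i y‖ < (1 / 2) ^ m
  have hnext : ∀ m (s : {s // Inv m s}), ∃ (s' : {s // Inv (m + 1) s})
      (u : C(unitInterval, unitaryGroup A)), u 0 = 1 ∧ s'.1.1.1 = s.1.1.2 ∧ s'.1.2.1 = s.1.2.2 ∧
        s'.1.2.2 = s.1.2.1 * u 1 ∧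
        (∀ i b, s'.1.1.2 i b = s.1.1.1 i (Ad (u 1 : unitary A⁺¹) b)) ∧
        ∀ y ∈ F m s.1.2.1, ∀ t, ‖Ad (u t : unitary A⁺¹) y - y‖ < (1 / 2) ^ m := by
    rintro m ⟨⟨⟨p, q⟩, a, b⟩, hm, hG, -⟩
    obtain ⟨p', u, hu0, hu1, hu, hm', hclose⟩ := hstep m a hm hG (G (m + 1) b ∪ X (m + 1))
      (lt_min (hδ (m + 1) b) (hpow (m + 1)))
    refine ⟨⟨((q, p'), (b, a * u 1)), hm'.symm, fun i y hy => ?_, fun i y hy => ?_⟩, u, hu0, rfl,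
      rfl, rfl, hu1, hu⟩
    · rw [norm_sub_rev]
      exact (hclose i y (Finset.mem_union_left _ hy)).trans_le (min_le_left _ _)
    · rw [norm_sub_rev]
      exact (hclose i y (Finset.mem_union_right _ hy)).trans_le (min_le_right _ _)
  choose next u hu0 hp ha hb hq hu using hnext
  obtain ⟨s₀, hs₀1, hs₀2⟩ : ∃ s : {s // Inv 0 s},
      (∀ i b, s.1.1.1 i b = φ i (Ad (s.1.2.1 : unitary A⁺¹) b)) ∧
      ∀ i b, s.1.1.2 i b = ω i (Ad (s.1.2.2 : unitary A⁺¹) b) := by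
    obtain ⟨ξ, hξ, hm, hnear⟩ := h.symm.exists_near (G 0 1 ∪ X 0)
      (lt_min (hδ 0 1) (hpow 0))
    choose Ω hΩ hΩ' using fun i => (h.pure_right i).exists_eq_vectorFunctional
    obtain ⟨v, hv, hv'⟩ :=
      hA.exists_unitary_vectorFunctional h.pure_right h.disjoint_right ξ Ω hξ hΩ
    refine ⟨⟨((φ, fun i => vectorFunctional (ω i) (ξ i)), (1, ⟨v, hv⟩)), hm.symm,
      fun i y hy => ?_, fun i y hy => ?_⟩, fun i b => ?_, fun i b => ?_⟩
    · rw [norm_sub_rev]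
      exact (hnear i y (Finset.mem_union_left _ hy)).trans_le (min_le_left _ _)
    · rw [norm_sub_rev]
      exact (hnear i y (Finset.mem_union_right _ hy)).trans_le (min_le_right _ _)
    · exact congrArg _ (Ad_one_apply b).symm
    · have := hv' i b
      rwa [hΩ'] at this
  let S : ∀ m, {s // Inv m s} := fun m => Nat.rec s₀ (fun m s => next m s) m
  have hX : ∀ m j, j ≤ m → x j ∈ X m := fun m j hj =>
    Finset.mem_image_of_mem _ (Finset.mem_range.2 (Nat.lt_succ_of_le hj))
  have hP : ∀ m, (S (m + 1)).1.1.1 = (S m).1.1.2 := fun m => hp m (S m)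
  have hC : ∀ m, (S (m + 1)).1.2.1 = (S m).1.2.2 := fun m => ha m (S m)
  refine ⟨fun m => (S m).1.1.1, fun m => (S m).1.2.1, fun m => u m (S m), fun m => hu0 m (S m),
    fun m => ?_, hs₀1, fun i b => ?_, fun m i b => ?_, fun m j hj t => ?_, fun m j hj t => ?_,
    fun m j hj i => ?_⟩
  · exact (hC (m + 1)).trans (hb m (S m))
  · change (S (0 + 1)).1.1.1 i b = ω i (Ad ((S (0 + 1)).1.2.1 : unitary A⁺¹) b)
    rw [hP 0, hC 0]
    exact hs₀2 i b
  · change (S (m + 1 + 1)).1.1.1 i b = _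
    rw [hP (m + 1)]
    exact hq m (S m) i b
  · exact (hu m (S m) _ (Finset.mem_union_left _ (hX m j hj)) t).le
  · exact (hu m (S m) _ (Finset.mem_union_right _ (Finset.mem_image_of_mem _
      (Finset.mem_range.2 (Nat.lt_succ_of_le hj)))) t).le
  · change ‖(S m).1.1.1 i (x j) - (S (m + 1)).1.1.1 i (x j)‖ ≤ (1 / 2) ^ m
    rw [hP m]
    exact ((S m).2.2.2 i _ (hX m j hj)).le

theorem StrongTransitivityProperty.exists_asymptoticallyInner
    [TopologicalSpace.SeparableSpace A] (hA : StrongTransitivityProperty A) {n : ℕ}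
    {ω φ : Fin n → (A →ₚ[ℂ] ℂ)} (h : KernelMatched φ ω) :
    ∃ α : A ≃⋆ₐ[ℂ] A, IsAsymptoticallyInner α ∧ ∀ i, ∀ x : A, ω i x = φ i (α x) := by
  set x := TopologicalSpace.denseSeq A
  have hx : DenseRange x := TopologicalSpace.denseRange_denseSeq A
  obtain ⟨P, C, u, hu0, hC, hP0, hP1, hP, hF, hF', hclose⟩ :=
    hA.exists_intertwining_sequence x h
  have hpow : ∀ N k, N ≤ k → (1 / 2 : ℝ) ^ k ≤ (1 / 2) ^ N := fun N k hk =>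
    pow_le_pow_of_le_one (by norm_num) (by norm_num) hk
  obtain ⟨w, α, hw, hα, -, hcα⟩ := exists_path_tendsto_automorphism hx (fun N => u (2 * N))
    (fun N => hu0 _) (fun N => C (2 * N)) (fun N => hC (2 * N))
    (fun N j hj t => (hF _ j (by omega) t).trans (hpow _ _ (by omega)))
    (fun N j hj t => (hF' _ j (by omega) t).trans (hpow _ _ (by omega)))
  obtain ⟨w', β, hw', -, hβ, hcβ⟩ := exists_path_tendsto_automorphism hx
    (fun N => u (2 * N + 1)) (fun N => hu0 _) (fun N => C (2 * N + 1)) (fun N => hC (2 * N + 1))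
    (fun N j hj t => (hF _ j (by omega) t).trans (hpow _ _ (by omega)))
    (fun N j hj t => (hF' _ j (by omega) t).trans (hpow _ _ (by omega)))
  have hPe : ∀ N i b, P (2 * N) i b = φ i (Ad (C (2 * N) : unitary A⁺¹) b) := by
    intro N
    induction N with
    | zero => exact hP0
    | succ N ih =>
      intro i b
      rw [show 2 * (N + 1) = 2 * N + 2 by ring, hP, ih, hC, Subgroup.coe_mul, Ad_mul_apply]
  have hPo : ∀ N i b, P (2 * N + 1) i b = ω i (Ad (C (2 * N + 1) : unitary A⁺¹) b) := by
    intro N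
    induction N with
    | zero => exact hP1
    | succ N ih =>
      intro i b
      rw [show 2 * (N + 1) + 1 = 2 * N + 1 + 2 by ring, hP, ih, hC, Subgroup.coe_mul, Ad_mul_apply]
  have hcontα : Continuous α := (NonUnitalStarAlgHom.isometry α α.injective).continuous
  have hcontβ : Continuous β := (NonUnitalStarAlgHom.isometry β β.injective).continuous
  have hstate : ∀ i y, φ i (α y) = ω i (β y) := by
    intro i y
    refine congr_fun (hx.equalizer (g := fun y => φ i (α y)) (h := fun y => ω i (β y))
      ((map_continuous (φ i)).comp hcontα) ((map_continuous (ω i)).comp hcontβ)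
      (funext fun j => ?_)) y
    have h1 := ((map_continuous (φ i)).tendsto _).comp (hcα (x j))
    have h2 := ((map_continuous (ω i)).tendsto _).comp (hcβ (x j))
    refine eq_of_sub_eq_zero (tendsto_nhds_unique (h1.sub h2) ?_)
    refine squeeze_zero_norm' ?_ (tendsto_pow_atTop_nhds_zero_of_lt_one (r := (1 / 2 : ℝ))
      (by norm_num) (by norm_num))
    filter_upwards [eventually_ge_atTop j] with N hN
    simp only [Function.comp_apply]
    rw [← hPe, ← hPo]
    exact (hclose _ j (by omega) i).trans (hpow _ _ (by omega))
  -- The path of unitaries, reparametrized from `[0,∞)` to `[0,1)`.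
  let v : ℝ → unitaryGroup A := fun t => w (t * (1 - t)⁻¹) * (w' (t * (1 - t)⁻¹))⁻¹
  have hτ : Tendsto (fun t : ℝ => t * (1 - t)⁻¹) (𝓝[<] 1) atTop := by
    refine Tendsto.pos_mul_atTop one_pos (tendsto_id.mono_left nhdsWithin_le_nhds) ?_
    refine tendsto_inv_nhdsGT_zero.comp (tendsto_nhdsWithin_iff.2 ⟨?_, ?_⟩)
    · have : Tendsto (fun t : ℝ => 1 - t) (𝓝 1) (𝓝 (1 - 1)) := by
        exact (continuous_const.sub continuous_id).tendsto 1
      rw [sub_self] at this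
      exact this.mono_left nhdsWithin_le_nhds
    · filter_upwards [self_mem_nhdsWithin] with t ht
      exact Set.mem_Ioi.2 (sub_pos.2 (Set.mem_Iio.1 ht))
  have hv : ContinuousOn v (Set.Ico 0 1) := by
    have hτc : ContinuousOn (fun t : ℝ => t * (1 - t)⁻¹) (Set.Ico 0 1) :=
      continuousOn_id.mul ((continuousOn_const.sub continuousOn_id).inv₀ fun t ht =>
        (sub_pos.2 ht.2).ne')
    exact (hw.comp_continuousOn hτc).mul (hw'.comp_continuousOn hτc).inv
  have hlim : ∀ y : A, Tendsto (fun t => Ad (v t : unitary A⁺¹) y) (𝓝[<] 1)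
      (𝓝 ((β.symm.trans α) y)) := by
    intro y
    have h1 : Tendsto (fun t => Ad (w t : unitary A⁺¹) (Ad (w' t : unitary A⁺¹)⁻¹ y)) atTop
        (𝓝 (α (β.symm y))) := by
      have h2 := tendsto_iff_norm_sub_tendsto_zero.1 (hβ y)
      have h3 : Tendsto (fun t => Ad (w t : unitary A⁺¹) (Ad (w' t : unitary A⁺¹)⁻¹ y) -
          Ad (w t : unitary A⁺¹) (β.symm y)) atTop (𝓝 0) :=
        tendsto_zero_iff_norm_tendsto_zero.2
          (h2.congr fun t => (norm_starAlgEquiv_sub _ _ _).symm)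
      simpa only [add_sub_cancel, add_zero] using (hα (β.symm y)).add h3
    refine (h1.comp hτ).congr fun t => ?_
    simp only [Function.comp_apply, v]
    rw [Subgroup.coe_mul, Subgroup.coe_inv, Ad_mul_apply]
  refine ⟨β.symm.trans α, ⟨?_, v, hv, hlim⟩, fun i y => ?_⟩
  · exact mem_closure_of_tendsto (f := fun t => (Ad (v t : unitary A⁺¹) : A → A))
      (tendsto_pi_nhds.2 hlim) (Eventually.of_forall fun t => ⟨_, (v t).2, rfl⟩)
  · rw [StarAlgEquiv.trans_apply, hstate, StarAlgEquiv.apply_symm_apply]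

end BackAndForth

end PureStateTransitivity

end

theorem mainTheorem9 {A : Type*} [NonUnitalCStarAlgebra A] [PartialOrder A] [StarOrderedRing A]
    [TopologicalSpace.SeparableSpace A]
    (hA : PureStateTransitivity.StrongTransitivityProperty A) :
    (∀ (n : ℕ) (ω φ : Fin n → (A →ₚ[ℂ] ℂ)),
      (∀ i, PureStateTransitivity.IsPureState (ω i)) →
      (∀ i, PureStateTransitivity.IsPureState (φ i)) →
      (∀ i j, i ≠ j → PureStateTransitivity.StateDisjoint (ω i) (ω j)) →
      (∀ i j, i ≠ j → PureStateTransitivity.StateDisjoint (φ i) (φ j)) →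
      (∀ i, PureStateTransitivity.gnsKer (ω i) = PureStateTransitivity.gnsKer (φ i)) →
      ∃ α : A ≃⋆ₐ[ℂ] A, PureStateTransitivity.IsAsymptoticallyInner α ∧
        ∀ i, ∀ x : A, ω i x = φ i (α x)) ∧
    (∀ (n : ℕ) (ω : Fin (n + 1) → (A →ₚ[ℂ] ℂ)),
      (∀ i, PureStateTransitivity.IsPureState (ω i)) →
      (∀ i j, i ≠ j → ¬ (i = 0 ∧ j = Fin.last n) → ¬ (i = Fin.last n ∧ j = 0) →
        PureStateTransitivity.StateDisjoint (ω i) (ω j)) →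
      (∀ i j, PureStateTransitivity.gnsKer (ω i) = PureStateTransitivity.gnsKer (ω j)) →
      ∃ α : A ≃⋆ₐ[ℂ] A, PureStateTransitivity.IsAsymptoticallyInner α ∧
        ∀ i : Fin n, ∀ x : A, ω i.castSucc (α x) = ω i.succ x) := by
  refine ⟨fun n ω φ hω hφ hdω hdφ hker => ?_, fun n ω hω hdisj hker => ?_⟩
  · exact hA.exists_asymptoticallyInner ⟨hφ, hω, hdφ, hdω, fun i => (hker i).symm⟩
  · -- the tuple `ω ∘ succ` is matched with `ω ∘ castSucc`; neither contains both `ω 0` and `ω n`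
    obtain ⟨α, hα, h⟩ := hA.exists_asymptoticallyInner (n := n) (ω := fun i => ω i.succ)
      (φ := fun i => ω i.castSucc)
      ⟨fun i => hω _, fun i => hω _,
        fun i j hij => hdisj _ _ (fun h => hij (Fin.castSucc_injective n h))
          (fun h => (Fin.castSucc_lt_last j).ne h.2) (fun h => (Fin.castSucc_lt_last i).ne h.1),
        fun i j hij => hdisj _ _ (fun h => hij (Fin.succ_injective n h))
          (fun h => Fin.succ_ne_zero i h.1) (fun h => Fin.succ_ne_zero j h.2),
        fun i => hker _ _⟩
    exact ⟨α, hα, fun i x => (h i x).symm⟩
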